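/- Let $A\in\mathbb R^{m\times n}$, let $1\le k\le \operatorname{rank}A$, let $A=U_A\Sigma_AV_A^T$ be a (compact) singular value decomposition, $U_{A,k}$ the matrix of the top $k$ left singular vectors, and $A_k=U_{A,k}\Sigma_{A,k}V_{A,k}^T$. Let $s\ge1$ and split the columns into $G=\lceil n/s\rceil$ consecutive blocks of $s$ columns (the last one possibly shorter); let $E_i$ be the corresponding block of columns of the identity matrix. For $R\in\mathbb R^{r\times n}$, $R\neq0$, let $V_R$ be the matrix of its right singular vectors belonging to nonzero singular values, and let $\alpha_R=\min_{i}\|V_R^TE_i\|_F^2/\|V_R^TE_i\|_2^2$ be its block stable rank, the minimum being over the blocks with $V_R^TE_i\neq0$. One run of block CUR with full SVD and parameters $r$, $g$ is the following. Draw $i_1,\dots,i_r\in[m]$ independently with the row leverage probabilities $p_i=\|e_i^TU_{A,k}\|_2^2/k$ and put $R=S_R^TA$, where column $t$ of $S_R$ is $e_{i_t}/\sqrt{r\,p_{i_t}}$. Then draw $g=g(R)$ blocks $j_1,\dots,j_g\in[G]$ independently with the block leverage probabilities $q_i=\|V_R^TE_i\|_F^2/\operatorname{rank}R$, and put $C=AS$,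 where the $t$-th block of columns of $S$ is $E_{j_t}/\sqrt{g\,q_{j_t}}$. Finally put $U=W^\dagger$, where $W=RS$ is the scaled intersection of $C$ and $R$. The boosted algorithm makes $T$ independent runs and returns the output $(C,U,R)$ with the smallest error $\|A-CUR\|_F$. There are absolute constants $c,c'>0$ such that for all such $A,k,s$ and all $\varepsilon,\delta\in(0,1)$ the following holds. If $$r\ge c\,\frac{k^2}{\varepsilon^2},\qquad g(R)\ge c\,\frac{r^2}{\alpha_R\,\varepsilon^2}\ \text{ for all } R\neq 0,\qquad T\ge\ln\frac1\delta,\quad T\geq 1,$$ then the output of the boosted algorithm satisfies, with probability at least $1-\delta$, $$\|A-CUR\|_F\le(1+\varepsilon)\,\|A-A_k\|_F .$$ Moreover $r$, $T$, $g$ can be chosen to satisfy these conditions and $$T\,r\le c'\,\frac{k^2}{\varepsilon^2}\Big\lceil\ln\frac1\delta\Big\rceil,\qquad T\,g(R)\le c'\,\frac{r^2}{\alpha_R\,\varepsilon^2}\Big\lceil\ln\frac1\delta\Big\rceil\ \text{ for all } R\neq 0,$$ so that in total $O\big(\frac{k^2}{\varepsilon^2}\ln\frac1\delta\big)$ rows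 and $O\big(\frac{r^2}{\alpha_R\varepsilon^2}\ln\frac1\delta\big)$ column blocks are chosen (with $\ln\frac1\delta$ rounded up to an integer). -/

import Mathlib

open Matrix
open scoped ENNReal

noncomputable section

namespace BlockCUR

/-! ### Norms, singular value decomposition, pseudoinverse -/

/-- The Frobenius norm. -/
def frobNorm {a b : Type*} [Fintype a] [Fintype b] (M : Matrix a b ℝ) : ℝ :=
  √(∑ i, ∑ j, M i j ^ 2)

open scoped Matrix.Norms.L2Operator in
/-- The spectral norm (operator norm between Euclidean spaces, the largest singular value). -/
def specNorm {a b : Type*} [Fintype a] [Fintype b] [DecidableEq b] (M : Matrix a b ℝ) : ℝ :=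
  ‖M‖

/-- A (compact) singular value decomposition `A = U Σ Vᵀ`, with `ρ = rank A` singular values, which
are positive and in decreasing order, and orthonormal left and right singular vectors, the columns
of `U` and `V`. -/
structure CompactSVD {a b : Type*} [Fintype a] [Fintype b] (A : Matrix a b ℝ) where
  U : Matrix a (Fin A.rank) ℝ
  σ : Fin A.rank → ℝ
  V : Matrix b (Fin A.rank) ℝ
  orthoU : Uᵀ * U = 1
  orthoV : Vᵀ * V = 1
  σ_pos : ∀ i, 0 < σ i
  σ_anti : Antitone σ
  eq : A = U * diagonal σ * Vᵀ

/-- The first `k` columns of a matrix with `ρ ≥ k` columns. -/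
def topCols {a : Type*} {ρ : ℕ} (k : ℕ) (h : k ≤ ρ) (M : Matrix a (Fin ρ) ℝ) :
    Matrix a (Fin k) ℝ :=
  M.submatrix id (Fin.castLE h)

/-- The rank-`k` approximation `A_k = U_k Σ_k V_kᵀ` given by the top `k` singular triples. -/
def CompactSVD.trunc {a b : Type*} [Fintype a] [Fintype b] {A : Matrix a b ℝ}
    (D : CompactSVD A) (k : ℕ) (h : k ≤ A.rank) : Matrix a b ℝ :=
  topCols k h D.U * diagonal (fun i => D.σ (Fin.castLE h i)) * (topCols k h D.V)ᵀ

theorem topCols_ortho {a : Type*} [Fintype a] {ρ : ℕ} (k : ℕ) (h : k ≤ ρ)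
    (M : Matrix a (Fin ρ) ℝ) (hM : Mᵀ * M = 1) : (topCols k h M)ᵀ * topCols k h M = 1 := by
  ext i j
  have := congrFun (congrFun hM (Fin.castLE h i)) (Fin.castLE h j)
  simpa [topCols, Matrix.mul_apply, Matrix.one_apply] using this

/-- Every real matrix has a singular value decomposition. -/
theorem CompactSVD.nonempty {a b : Type*} [Fintype a] [Fintype b] (A : Matrix a b ℝ) :
    Nonempty (CompactSVD A) := by
  classical
  set T : EuclideanSpace ℝ b →ₗ[ℝ] EuclideanSpace ℝ a := Matrix.toLpLin 2 2 A with hT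
  have hn : Module.finrank ℝ (EuclideanSpace ℝ b) = Fintype.card b := finrank_euclideanSpace
  have hρ : Module.finrank ℝ (LinearMap.range T) = A.rank := by
    rw [Matrix.rank_eq_finrank_range_toLin A (PiLp.basisFun 2 ℝ a) (PiLp.basisFun 2 ℝ b)]
    rw [hT, Matrix.toLpLin_eq_toLin]
  have hle : A.rank ≤ Fintype.card b := A.rank_le_card_width
  set e := T.isSymmetric_adjoint_comp_self.eigenvectorBasis hn with he
  have key : ∀ i j, inner ℝ (T (e i)) (T (e j)) =
      if i = j then (T.singularValues j) ^ 2 else 0 := by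
    intro i j
    have h1 : (LinearMap.adjoint T ∘ₗ T) (e j) = (T.singularValues j ^ 2) • e j := by
      rw [T.sq_singularValues_fin hn j]
      exact T.isSymmetric_adjoint_comp_self.apply_eigenvectorBasis hn j
    rw [← LinearMap.adjoint_inner_right, ← LinearMap.comp_apply, h1, inner_smul_right,
      orthonormal_iff_ite.mp e.orthonormal i j]
    split_ifs <;> simp
  have hz : ∀ j : Fin (Fintype.card b), A.rank ≤ j → T (e j) = 0 := by
    intro j hj
    have h1 := key j j
    rw [if_pos rfl, T.singularValues_eq_zero_iff_le_finrank_range.mpr (by rw [hρ]; exact hj)] at h1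
    simpa using h1
  have hpos : ∀ i : Fin A.rank, 0 < T.singularValues i := fun i =>
    T.singularValues_pos_iff_lt_finrank_range.mpr (by rw [hρ]; exact i.2)
  refine ⟨⟨Matrix.of fun i l => (T.singularValues l)⁻¹ * (T (e (Fin.castLE hle l))) i,
    fun l => T.singularValues l, Matrix.of fun i l => (e (Fin.castLE hle l)) i, ?_, ?_, hpos,
    fun i j h => T.singularValues_antitone h, ?_⟩⟩
  · ext i j
    have h1 := key (Fin.castLE hle i) (Fin.castLE hle j)
    have hi := (hpos i).ne'
    have hj := (hpos j).ne'
    simp only [PiLp.inner_apply, RCLike.inner_apply, conj_trivial] at h1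
    simp only [Matrix.mul_apply, Matrix.transpose_apply, Matrix.of_apply, Matrix.one_apply]
    have h2 : ∀ x : a, (T.singularValues i)⁻¹ * (T (e (Fin.castLE hle i))) x *
        ((T.singularValues j)⁻¹ * (T (e (Fin.castLE hle j))) x) =
        (T.singularValues i)⁻¹ * (T.singularValues j)⁻¹ *
        ((T (e (Fin.castLE hle j))) x * (T (e (Fin.castLE hle i))) x) := fun x => by ring
    rw [Finset.sum_congr rfl fun x _ => h2 x, ← Finset.mul_sum, h1]
    by_cases hij : i = j
    · subst hij
      simp only [if_true, Fin.val_castLE]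
      field_simp
    · simp [hij]
  · ext i j
    have h1 := orthonormal_iff_ite.mp e.orthonormal (Fin.castLE hle i) (Fin.castLE hle j)
    simp only [PiLp.inner_apply, RCLike.inner_apply, conj_trivial] at h1
    simp only [Matrix.mul_apply, Matrix.transpose_apply, Matrix.of_apply, Matrix.one_apply]
    simp only [mul_comm] at h1 ⊢
    rw [h1]
    simp
  · have hsum : ∀ i l, A i l = ∑ j, (T (e j)) i * (e j) l := by
      intro i l
      have h1 := e.sum_repr (EuclideanSpace.single l (1 : ℝ))
      have h2 := congrArg (fun v => (T v) i) h1
      simp only [map_sum, map_smul] at h2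
      have h3 : (T (EuclideanSpace.single l (1 : ℝ))) i = A i l := by
        simp [hT, Matrix.toLpLin_apply]
      rw [h3] at h2
      rw [← h2]
      simp [e.repr_apply_apply, EuclideanSpace.inner_single_right, mul_comm]
    ext i l
    rw [hsum]
    rw [Matrix.mul_apply]
    simp only [Matrix.mul_diagonal, Matrix.transpose_apply, Matrix.of_apply]
    have h4 : ∀ x : Fin A.rank, (T.singularValues x)⁻¹ * (T (e (Fin.castLE hle x))) i *
        T.singularValues x * (e (Fin.castLE hle x)) l =
        (T (e (Fin.castLE hle x))) i * (e (Fin.castLE hle x)) l := fun x => by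
      have := (hpos x).ne'
      field_simp
    rw [Finset.sum_congr rfl fun x _ => h4 x]
    symm
    refine (Finset.sum_map Finset.univ (Fin.castLEEmb hle)
      (fun j => (T (e j)) i * (e j) l)).symm.trans ?_
    apply Finset.sum_subset (Finset.subset_univ _)
    intro j _ hj
    rw [hz j, PiLp.zero_apply, zero_mul]
    by_contra hlt
    exact hj (Finset.mem_map.mpr ⟨⟨j, not_le.mp hlt⟩, Finset.mem_univ _, rfl⟩)

/-- The pseudoinverse `A† = V Σ⁻¹ Uᵀ` (the value does not depend on the decomposition). -/
def pinv {a b : Type*} [Fintype a] [Fintype b] (A : Matrix a b ℝ) : Matrix b a ℝ :=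
  let D := (CompactSVD.nonempty A).some
  D.V * diagonal (fun i => (D.σ i)⁻¹) * D.Uᵀ

/-! ### Row leverage scores -/

/-- The leverage score of row `i`: the squared norm of row `i` of `U`. -/
def rowLeverage {m q : ℕ} (U : Matrix (Fin m) (Fin q) ℝ) (i : Fin m) : ℝ :=
  ∑ l, U i l ^ 2

/-- Sampling probabilities `‖e_iᵀ U‖² / q` of the rows, `q` being the number of columns of `U`. -/
def rowProb {m q : ℕ} (U : Matrix (Fin m) (Fin q) ℝ) (i : Fin m) : ℝ :=
  rowLeverage U i / q

theorem sum_sq_of_ortho {m q : ℕ} (U : Matrix (Fin m) (Fin q) ℝ) (hU : Uᵀ * U = 1) :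
    ∑ i, ∑ l, U i l ^ 2 = q := by
  rw [Finset.sum_comm]
  have h : ∀ l : Fin q, ∑ i, U i l ^ 2 = 1 := fun l => by
    have := congrFun (congrFun hU l) l
    simpa [Matrix.mul_apply, pow_two] using this
  simp [h]

theorem sum_rowProb {m q : ℕ} (hq : 0 < q) (U : Matrix (Fin m) (Fin q) ℝ) (hU : Uᵀ * U = 1) :
    ∑ i, ENNReal.ofReal (rowProb U i) = 1 := by
  rw [← ENNReal.ofReal_sum_of_nonneg]
  · have hq' : (q : ℝ) ≠ 0 := by positivity
    simp only [rowProb, rowLeverage]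
    rw [← Finset.sum_div, sum_sq_of_ortho U hU, div_self hq', ENNReal.ofReal_one]
  · intro i _
    unfold rowProb rowLeverage
    positivity

/-- The law of one sampled row index. -/
def rowPMF {m q : ℕ} (hq : 0 < q) (U : Matrix (Fin m) (Fin q) ℝ) (hU : Uᵀ * U = 1) :
    PMF (Fin m) :=
  PMF.ofFintype (fun i => ENNReal.ofReal (rowProb U i)) (sum_rowProb hq U hU)

/-- The sampling and rescaling matrix `S_R` of the rows `i₁, …, i_r`, drawn with probabilities
`p`: its column `t` is `e_{i_t} / √(r p_{i_t})`. -/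
def rowSampling {m r : ℕ} (p : Fin m → ℝ) (i : Fin r → Fin m) : Matrix (Fin m) (Fin r) ℝ :=
  Matrix.of fun a t => if a = i t then 1 / √(r * p (i t)) else 0

/-! ### Blocks of columns -/

/-- `E_i` for the `i`-th of the `G = ⌈n / s⌉` blocks of `s` consecutive columns: the columns
`i s, …, i s + s - 1` of the identity matrix (columns past the `n`-th, which can only occur in the
last block, are zero). -/
def blockSel (n s : ℕ) (i : Fin (n ⌈/⌉ s)) : Matrix (Fin n) (Fin s) ℝ :=
  Matrix.of fun j l => if (j : ℕ) = i * s + l then 1 else 0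

/-- The block leverage score `‖Vᵀ E_i‖_F²`. -/
def blockLeverage {n q : ℕ} (s : ℕ) (V : Matrix (Fin n) (Fin q) ℝ) (i : Fin (n ⌈/⌉ s)) : ℝ :=
  frobNorm (Vᵀ * blockSel n s i) ^ 2

/-- Sampling probabilities `‖Vᵀ E_i‖_F² / q` of the blocks, `q` being the number of columns
of `V`. -/
def blockProb {n q : ℕ} (s : ℕ) (V : Matrix (Fin n) (Fin q) ℝ) (i : Fin (n ⌈/⌉ s)) : ℝ :=
  blockLeverage s V i / q

/-- Every column lies in exactly one position of exactly one block. -/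
theorem sum_block_position {n s : ℕ} (hs : 0 < s) (j : Fin n) (f : ℝ) :
   ∑ i : Fin (n ⌈/⌉ s), ∑ l : Fin s, (if (j : ℕ) = i * s + l then f else 0) = f := by
  have hj : (j : ℕ) / s < n ⌈/⌉ s := by
    by_contra h
    have h1 := (ceilDiv_le_iff_le_smul hs).mp (not_lt.mp h)
    have h2 : s * (j / s) ≤ j := Nat.mul_div_le _ _
    have := j.2
    simp only [smul_eq_mul] at h1
    omega
  rw [Finset.sum_eq_single ⟨j / s, hj⟩, Finset.sum_eq_single ⟨j % s, Nat.mod_lt _ hs⟩]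
  · exact if_pos (Nat.div_add_mod' _ _).symm
  · intro l _ hl
    rw [if_neg]
    intro h
    apply hl
    ext
    exact Nat.add_left_cancel (h.symm.trans (Nat.div_add_mod' (j : ℕ) s).symm)
  · simp
  · intro i _ hi
    apply Finset.sum_eq_zero
    intro l _
    rw [if_neg]
    intro h
    apply hi
    ext
    simp only [h]
    rw [mul_comm, Nat.mul_add_div hs, Nat.div_eq_of_lt l.2, add_zero]
  · simp

theorem sum_blockLeverage {n q : ℕ} {s : ℕ} (hs : 0 < s) (V : Matrix (Fin n) (Fin q) ℝ) :
    ∑ i, blockLeverage s V i = ∑ j, ∑ l, V j l ^ 2 := by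
  have h1 : ∀ i (x : Fin q) (l : Fin s), (Vᵀ * blockSel n s i) x l ^ 2 =
      ∑ j : Fin n, if (j : ℕ) = i * s + l then V j x ^ 2 else 0 := by
    intro i x l
    simp only [Matrix.mul_apply, Matrix.transpose_apply, blockSel, Matrix.of_apply, mul_ite,
      mul_one, mul_zero]
    by_cases h : (i : ℕ) * s + l < n
    · rw [Finset.sum_eq_single ⟨i * s + l, h⟩, Finset.sum_eq_single ⟨i * s + l, h⟩]
      · simp
      · intro j _ hj
        exact if_neg fun h' => hj (Fin.ext h')
      · simp
      · intro j _ hj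
        exact if_neg fun h' => hj (Fin.ext h')
      · simp
    · have h2 : ∀ j : Fin n, ¬ (j : ℕ) = i * s + l := fun j hj => h (hj ▸ j.2)
      simp [h2]
  have h2 : ∀ i, frobNorm (Vᵀ * blockSel n s i) ^ 2 =
      ∑ x : Fin q, ∑ l : Fin s, ∑ j : Fin n, if (j : ℕ) = i * s + l then V j x ^ 2 else 0 := by
    intro i
    rw [frobNorm, Real.sq_sqrt (by positivity)]
    simp only [h1]
  simp only [blockLeverage, h2]
  calc _ = ∑ x : Fin q, ∑ j : Fin n, ∑ i : Fin (n ⌈/⌉ s), ∑ l : Fin s,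
        (if (j : ℕ) = i * s + l then V j x ^ 2 else 0) := by
        rw [Finset.sum_comm]
        refine Finset.sum_congr rfl fun x _ => ?_
        symm
        refine Finset.sum_comm.trans (Finset.sum_congr rfl fun i _ => ?_)
        exact Finset.sum_comm
    _ = _ := by
        simp only [sum_block_position hs]
        exact Finset.sum_comm

theorem sum_blockProb {n q : ℕ} {s : ℕ} (hs : 0 < s) (hq : 0 < q) (V : Matrix (Fin n) (Fin q) ℝ)
    (hV : Vᵀ * V = 1) : ∑ i, ENNReal.ofReal (blockProb s V i) = 1 := by
  rw [← ENNReal.ofReal_sum_of_nonneg]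
  · have hq' : (q : ℝ) ≠ 0 := by positivity
    simp only [blockProb]
    rw [← Finset.sum_div, sum_blockLeverage hs, sum_sq_of_ortho V hV, div_self hq',
      ENNReal.ofReal_one]
  · intro i _
    unfold blockProb blockLeverage
    positivity

/-- The law of one sampled block index. -/
def blockPMF {n q s : ℕ} (hs : 0 < s) (hq : 0 < q) (V : Matrix (Fin n) (Fin q) ℝ)
    (hV : Vᵀ * V = 1) : PMF (Fin (n ⌈/⌉ s)) :=
  PMF.ofFintype (fun i => ENNReal.ofReal (blockProb s V i)) (sum_blockProb hs hq V hV)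

/-- The sampling and rescaling matrix `S` of the blocks `j₁, …, j_g`, drawn with probabilities
`p`: its `t`-th block of `s` columns is `E_{j_t} / √(g p_{j_t})`. -/
def blockSampling {n s g : ℕ} (p : Fin (n ⌈/⌉ s) → ℝ) (j : Fin g → Fin (n ⌈/⌉ s)) :
    Matrix (Fin n) (Fin g × Fin s) ℝ :=
  Matrix.of fun a tl => blockSel n s (j tl.1) a tl.2 / √(g * p (j tl.1))

/-- The block stable rank `α = min_i ‖Vᵀ E_i‖_F² / ‖Vᵀ E_i‖_2²`, over the blocks for which the
quotient makes sense, that is, `Vᵀ E_i ≠ 0`. -/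
def blockStableRank {n q : ℕ} (s : ℕ) (V : Matrix (Fin n) (Fin q) ℝ) : ℝ :=
  ⨅ i : {i : Fin (n ⌈/⌉ s) // Vᵀ * blockSel n s i ≠ 0},
    frobNorm (Vᵀ * blockSel n s i.1) ^ 2 / specNorm (Vᵀ * blockSel n s i.1) ^ 2

/-! ### The algorithm -/

/-- The law of `N` independent draws from `p`. -/
def iid {α : Type} (p : PMF α) : (N : ℕ) → PMF (Fin N → α)
  | 0 => PMF.pure Fin.elim0
  | N + 1 => p.bind fun x => (iid p N).map fun f => Fin.cons x f

/-- The output of a run: `g` blocks of `s` columns `C`, `r` rows `R`, and the matrix `U`. -/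
structure Factors (m n s r : ℕ) where
  g : ℕ
  C : Matrix (Fin m) (Fin g × Fin s) ℝ
  U : Matrix (Fin g × Fin s) (Fin r) ℝ
  R : Matrix (Fin r) (Fin n) ℝ

/-- The error `‖A - C U R‖_F`. -/
def Factors.err {m n s r : ℕ} (A : Matrix (Fin m) (Fin n) ℝ) (X : Factors m n s r) : ℝ :=
  frobNorm (A - X.C * X.U * X.R)

/-- One run of block CUR with full SVD. First `r` rows are drawn independently with probabilities
`‖e_iᵀ U_{A,k}‖² / k` and `R = S_Rᵀ A`. Then `g R` blocks of columns are drawn independently with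
probabilities given by the block leverage scores of `R`, and `C = A S`, `U = (R S)†`.
`svd R` is the singular value decomposition of `R` that is used; `R = 0` has probability zero, and
then no block is drawn. -/
def run {m n s k r : ℕ} (hs : 0 < s) (hk : 0 < k) {A : Matrix (Fin m) (Fin n) ℝ}
    (D : CompactSVD A) (hkA : k ≤ A.rank)
    (svd : (R : Matrix (Fin r) (Fin n) ℝ) → CompactSVD R)
    (g : Matrix (Fin r) (Fin n) ℝ → ℕ) : PMF (Factors m n s r) :=
  let Uk := topCols k hkA D.U
  (iid (rowPMF hk Uk (topCols_ortho k hkA D.U D.orthoU)) r).bind fun i =>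
    let R := (rowSampling (rowProb Uk) i)ᵀ * A
    if hR : 0 < R.rank then
      (iid (blockPMF hs hR (svd R).V (svd R).orthoV) (g R)).map fun j =>
        let S := blockSampling (blockProb s (svd R).V) j
        { g := g R, C := A * S, U := pinv (R * S), R := R }
    else PMF.pure { g := 0, C := 0, U := 0, R := R }

/-- An output of smallest error among `T` outputs. -/
def best {m n s r T : ℕ} (hT : 0 < T) (A : Matrix (Fin m) (Fin n) ℝ)
    (X : Fin T → Factors m n s r) : Factors m n s r :=
  X (Finset.exists_min_image Finset.univ (fun t => (X t).err A)
    ⟨⟨0, hT⟩, Finset.mem_univ _⟩).choose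

/-- The boosted algorithm: `T` independent runs, of which one with the smallest error is kept. -/
def boosted {m n s k r : ℕ} (T : ℕ) (hT : 0 < T) (hs : 0 < s) (hk : 0 < k)
    {A : Matrix (Fin m) (Fin n) ℝ} (D : CompactSVD A) (hkA : k ≤ A.rank)
    (svd : (R : Matrix (Fin r) (Fin n) ℝ) → CompactSVD R)
    (g : Matrix (Fin r) (Fin n) ℝ → ℕ) : PMF (Factors m n s r) :=
  (iid (run hs hk D hkA svd g) T).map (best hT A)

end BlockCUR

end

/-! The proof is a second moment argument for two nested sketched regressions.

*Rows.* Write `A = U Y + P` with `U` the top `k` left singular vectors and `P = A - A_k`, so that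
`Uᵀ P = 0`. Solving the regression of `A` on `U` through the sketch `S_Rᵀ` gives an approximation
`X R` of `A` whose rows lie in the row space of `R = S_Rᵀ A`. Its error is `P - U N` with
`N = (Uᵀ S_R S_Rᵀ U)⁻¹ Uᵀ S_R S_Rᵀ P`, and `‖P - U N‖² = ‖P‖² + ‖N‖²` (`exists_row_approx`).

*Columns.* Let `V` be the right singular vectors of `R` and `B = A - A V Vᵀ`, which is at most as
large as `A - X R` (`frobNorm_sub_proj_le`). If `Vᵀ S` has full row rank, then
`(R S)† R = (Vᵀ S)ᵀ (Vᵀ S Sᵀ V)⁻¹ Vᵀ` (`pinv_mul_eq`). Hence the error `A - A S (R S)† R` is `B - N Vᵀ`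
with `N = B S Sᵀ V (Vᵀ S Sᵀ V)⁻¹`, and its square norm is `‖B‖² + ‖N‖²` (`frobNorm_sub_cur_sq_le`).

*Sampling.* Both regressions need that a sketch nearly preserves two matrix products, in Frobenius
norm: a Gram matrix, up to `1/2`, and a vanishing product, up to `ε/2` times the norm of the residual.
Importance sampling has second moment error at most `N⁻¹ ∑ ‖X_i‖² / p_i` (`expect_iid_matrix_le`). For
leverage scores this is `k ‖Q‖² / r` for the product `Uᵀ Q` (`expect_rowSampling_le`), and at most
`rank R ‖P‖² / (α g)` for the product `P V` (`expect_blockSampling_le`). With the constant `c = 48`,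
Markov's inequality bounds each of the four failure probabilities by `1/12`, so that one run fails
with probability at most `1/3 < 1/e`, and `T ≥ ln (1/δ)` independent runs all fail with probability at
most `δ`. The two losses `1 + ε²` in the squared error multiply to at most `(1 + ε)²`. -/

namespace BlockCUR

/-! ### Frobenius and spectral norms -/

section Frobenius

variable {a b d : Type*} [Fintype a] [Fintype b] [Fintype d]

theorem frobNorm_nonneg (M : Matrix a b ℝ) : 0 ≤ frobNorm M := Real.sqrt_nonneg _

theorem frobNorm_sq (M : Matrix a b ℝ) : frobNorm M ^ 2 = ∑ i, ∑ j, M i j ^ 2 :=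
  Real.sq_sqrt (by positivity)

theorem frobNorm_sq_eq_trace (M : Matrix a b ℝ) : frobNorm M ^ 2 = (M * Mᵀ).trace := by
  rw [frobNorm_sq]
  simp [Matrix.trace, Matrix.mul_apply, pow_two]

open scoped Matrix.Norms.Frobenius in
theorem frobNorm_eq_norm (M : Matrix a b ℝ) : frobNorm M = ‖M‖ := by
  rw [Matrix.frobenius_norm_def, ← Real.sqrt_eq_rpow, frobNorm]
  simp

theorem frobNorm_transpose (M : Matrix a b ℝ) : frobNorm Mᵀ = frobNorm M := by
  unfold frobNorm
  rw [Finset.sum_comm]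
  rfl

open scoped Matrix.Norms.Frobenius in
theorem frobNorm_mul_le (M : Matrix a b ℝ) (N : Matrix b d ℝ) :
    frobNorm (M * N) ≤ frobNorm M * frobNorm N := by
  simp only [frobNorm_eq_norm]
  exact Matrix.frobenius_norm_mul M N

open scoped Matrix.Norms.Frobenius in
theorem frobNorm_sub_le (M N : Matrix a b ℝ) : frobNorm (M - N) ≤ frobNorm M + frobNorm N := by
  simp only [frobNorm_eq_norm]
  exact norm_sub_le M N

open scoped Matrix.Norms.Frobenius in
theorem frobNorm_eq_zero {M : Matrix a b ℝ} : frobNorm M = 0 ↔ M = 0 := by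
  simp only [frobNorm_eq_norm]
  exact norm_eq_zero

theorem frobNorm_neg (M : Matrix a b ℝ) : frobNorm (-M) = frobNorm M := by
  simp [frobNorm]

/-- Pythagoras for matrices with orthogonal row spaces. -/
theorem frobNorm_sq_add_of_mul_transpose_eq_zero {M N : Matrix a b ℝ} (h : M * Nᵀ = 0) :
    frobNorm (M + N) ^ 2 = frobNorm M ^ 2 + frobNorm N ^ 2 := by
  have h' : N * Mᵀ = 0 := by simpa using congrArg Matrix.transpose h
  simp only [frobNorm_sq_eq_trace, transpose_add, Matrix.add_mul, Matrix.mul_add, h, h',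
    trace_add, trace_zero]
  ring

theorem frobNorm_mul_transpose_of_ortho [DecidableEq d] {V : Matrix b d ℝ} (hV : Vᵀ * V = 1)
    (N : Matrix a d ℝ) : frobNorm (N * Vᵀ) = frobNorm N := by
  rw [← sq_eq_sq₀ (frobNorm_nonneg _) (frobNorm_nonneg _), frobNorm_sq_eq_trace,
    frobNorm_sq_eq_trace, transpose_mul, transpose_transpose, Matrix.mul_assoc,
    ← Matrix.mul_assoc Vᵀ, hV, Matrix.one_mul]

/-- A matrix within Frobenius distance `1/2` of the identity is invertible: a kernel vector `v`
would satisfy `‖v‖ ≤ ‖v‖ / 2`. -/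
theorem isUnit_det_of_frobNorm_sub_one_le [DecidableEq d] {H : Matrix d d ℝ}
    (hH : frobNorm (H - 1) ≤ 1 / 2) : IsUnit H.det := by
  rw [isUnit_iff_ne_zero]
  intro h0
  obtain ⟨v, hv, hHv⟩ := Matrix.exists_mulVec_eq_zero_iff.mpr h0
  have h1 : H * replicateCol Unit v = 0 := by
    rw [← replicateCol_mulVec, hHv]
    rfl
  have h2 : frobNorm (replicateCol Unit v) ≤ 1 / 2 * frobNorm (replicateCol Unit v) := by
    have h3 := frobNorm_mul_le (H - 1) (replicateCol Unit v)
    rw [Matrix.sub_mul, h1, Matrix.one_mul, zero_sub, frobNorm_neg] at h3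
    exact h3.trans (mul_le_mul_of_nonneg_right hH (frobNorm_nonneg _))
  have h3 : replicateCol Unit v = 0 :=
    frobNorm_eq_zero.mp (by linarith [frobNorm_nonneg (replicateCol Unit v)])
  exact hv (funext fun i => congrFun (congrFun h3 i) ())

/-- The inverse of a matrix within `1/2` of the identity at most doubles norms: `N = M H⁻¹` satisfies
`N = M - N (H - 1)`. -/
theorem frobNorm_mul_inv_le [DecidableEq d] {H : Matrix d d ℝ}
    (hH : frobNorm (H - 1) ≤ 1 / 2) (M : Matrix a d ℝ) :
    frobNorm (M * H⁻¹) ≤ 2 * frobNorm M := by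
  have hu := isUnit_det_of_frobNorm_sub_one_le hH
  set N := M * H⁻¹ with hN
  have h1 : N = M - N * (H - 1) := by
    rw [Matrix.mul_sub, hN, Matrix.mul_assoc, Matrix.nonsing_inv_mul _ hu]
    simp
  have h2 := frobNorm_sub_le M (N * (H - 1))
  rw [← h1] at h2
  have h3 := (frobNorm_mul_le N (H - 1)).trans
    (mul_le_mul_of_nonneg_left hH (frobNorm_nonneg _))
  linarith

theorem sum_sq_mulVec_le [DecidableEq b] (M : Matrix a b ℝ) (v : b → ℝ) :
    ∑ i, (M *ᵥ v) i ^ 2 ≤ specNorm M ^ 2 * ∑ j, v j ^ 2 := by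
  have h := Matrix.l2_opNorm_mulVec M (WithLp.toLp 2 v)
  have h' := pow_le_pow_left₀ (norm_nonneg _) h 2
  rw [mul_pow, EuclideanSpace.norm_sq_eq, EuclideanSpace.norm_sq_eq] at h'
  simpa [specNorm] using h'

/-- `‖P Mᵀ‖_F ≤ ‖P‖_F ‖M‖₂`, by applying `M` to the rows of `P`. -/
theorem frobNorm_mul_transpose_sq_le [DecidableEq b] (P : Matrix d b ℝ) (M : Matrix a b ℝ) :
    frobNorm (P * Mᵀ) ^ 2 ≤ frobNorm P ^ 2 * specNorm M ^ 2 := by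
  rw [frobNorm_sq, frobNorm_sq, Finset.sum_mul]
  refine Finset.sum_le_sum fun i _ => ?_
  have h := sum_sq_mulVec_le M (P i)
  rw [mul_comm]
  refine le_trans (le_of_eq ?_) h
  simp [Matrix.mul_apply, mulVec, dotProduct, mul_comm]

open scoped Matrix.Norms.L2Operator in
theorem specNorm_ne_zero [DecidableEq b] {M : Matrix a b ℝ} (h : M ≠ 0) : specNorm M ≠ 0 := by
  intro h0
  exact h (norm_eq_zero.mp h0)

/-- `‖M‖_F² ≤ (number of rows) ‖M‖₂²`: every row of `M` has norm at most `‖M‖₂`. -/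
theorem frobNorm_sq_le_card_mul_specNorm_sq [DecidableEq b] (M : Matrix a b ℝ) :
    frobNorm M ^ 2 ≤ Fintype.card a * specNorm M ^ 2 := by
  classical
  have h := frobNorm_mul_transpose_sq_le (1 : Matrix b b ℝ) M
  have key : ∀ x, ∑ j, M x j ^ 2 ≤ specNorm M ^ 2 := by
    intro x
    have h1 := sum_sq_mulVec_le Mᵀ (Pi.single x 1)
    have h2 : specNorm Mᵀ = specNorm M := by
      have := Matrix.l2_opNorm_conjTranspose M
      simpa [specNorm, conjTranspose_eq_transpose_of_trivial] using this
    rw [h2] at h1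
    simpa [Pi.single_apply, ite_pow] using h1
  rw [frobNorm_sq]
  simpa using Finset.sum_le_sum fun x (_ : x ∈ Finset.univ) => key x

end Frobenius

/-! ### The pseudoinverse -/

section Pinv

variable {a b : Type*} [Fintype a] [Fintype b]

/-- The four Penrose equations determine the pseudoinverse. -/
theorem eq_of_penrose {W : Matrix a b ℝ} {X Y : Matrix b a ℝ}
    (hX : X * W * X = X) (hWX : (W * X)ᵀ = W * X) (hXW : (X * W)ᵀ = X * W) (hW : W * X * W = W)
    (hY : Y * W * Y = Y) (hWY : (W * Y)ᵀ = W * Y) (hYW : (Y * W)ᵀ = Y * W) (hW' : W * Y * W = W) :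
    X = Y := by
  have h1 : W * X = W * Y := by
    calc W * X = (W * Y * W) * X := by rw [hW']
      _ = (W * Y)ᵀ * (W * X)ᵀ := by rw [hWY, hWX, Matrix.mul_assoc (W * Y)]
      _ = (W * X * W * Y)ᵀ := by rw [← transpose_mul]; simp only [Matrix.mul_assoc]
      _ = W * Y := by rw [hW, hWY]
  have h2 : X * W = Y * W := by
    calc X * W = X * (W * Y * W) := by rw [hW']
      _ = (X * W)ᵀ * (Y * W)ᵀ := by rw [hXW, hYW]; simp only [Matrix.mul_assoc]
      _ = (Y * (W * X * W))ᵀ := by rw [← transpose_mul]; simp only [Matrix.mul_assoc]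
      _ = Y * W := by rw [hW, hYW]
  calc X = X * W * X := hX.symm
    _ = Y * W * X := by rw [h2]
    _ = Y * (W * Y) := by rw [Matrix.mul_assoc, h1]
    _ = Y := by rw [← Matrix.mul_assoc, hY]

theorem pinv_eq_of_penrose {W : Matrix a b ℝ} {Y : Matrix b a ℝ}
    (hY : Y * W * Y = Y) (hWY : (W * Y)ᵀ = W * Y) (hYW : (Y * W)ᵀ = Y * W)
    (hW : W * Y * W = W) : pinv W = Y := by
  set D := (CompactSVD.nonempty W).some with hD
  have hp : pinv W = D.V * diagonal (fun i => (D.σ i)⁻¹) * D.Uᵀ := rfl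
  have hσ : ∀ i, D.σ i ≠ 0 := fun i => (D.σ_pos i).ne'
  have h1 : W * pinv W = D.U * D.Uᵀ := by
    calc W * pinv W = (D.U * diagonal D.σ * D.Vᵀ) * pinv W := by rw [← D.eq]
      _ = D.U * (diagonal D.σ * ((D.Vᵀ * D.V) * diagonal (fun i => (D.σ i)⁻¹))) * D.Uᵀ := by
        rw [hp]; simp only [Matrix.mul_assoc]
      _ = _ := by
        rw [D.orthoV, Matrix.one_mul, diagonal_mul_diagonal]
        simp [hσ]
  have h2 : pinv W * W = D.V * D.Vᵀ := by
    calc pinv W * W = pinv W * (D.U * diagonal D.σ * D.Vᵀ) := by rw [← D.eq]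
      _ = D.V * (diagonal (fun i => (D.σ i)⁻¹) * ((D.Uᵀ * D.U) * diagonal D.σ)) * D.Vᵀ := by
        rw [hp]; simp only [Matrix.mul_assoc]
      _ = _ := by
        rw [D.orthoU, Matrix.one_mul, diagonal_mul_diagonal]
        simp [hσ]
  refine eq_of_penrose ?_ ?_ ?_ ?_ hY hWY hYW hW
  · rw [h2, hp]
    simp only [Matrix.mul_assoc]
    rw [← Matrix.mul_assoc D.Vᵀ D.V, D.orthoV, Matrix.one_mul]
  · rw [h1]; simp
  · rw [h2]; simp
  · calc W * pinv W * W = D.U * D.Uᵀ * (D.U * diagonal D.σ * D.Vᵀ) := by rw [h1, ← D.eq]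
      _ = D.U * ((D.Uᵀ * D.U) * diagonal D.σ) * D.Vᵀ := by simp only [Matrix.mul_assoc]
      _ = W := by rw [D.orthoU, Matrix.one_mul, ← D.eq]

variable {d : Type*} [Fintype d]

/-- If `Y = Vᵀ S` has full row rank, then `(R S)† R = Yᵀ (Y Yᵀ)⁻¹ Vᵀ`. -/
theorem pinv_mul_eq {R : Matrix a b ℝ} (D : CompactSVD R) (S : Matrix b d ℝ)
    (hu : IsUnit (D.Vᵀ * S * (D.Vᵀ * S)ᵀ).det) :
    pinv (R * S) * R = (D.Vᵀ * S)ᵀ * (D.Vᵀ * S * (D.Vᵀ * S)ᵀ)⁻¹ * D.Vᵀ := by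
  set Y := D.Vᵀ * S with hYdef
  set H := Y * Yᵀ with hH
  have hHt : H⁻¹ᵀ = H⁻¹ := by
    rw [transpose_nonsing_inv, hH, transpose_mul, transpose_transpose]
  have hσ : ∀ i, D.σ i ≠ 0 := fun i => (D.σ_pos i).ne'
  -- `R = L Vᵀ` with left inverse `K` of `L`, and the pseudoinverse of `R S = L Y` is `Yᵀ (Y Yᵀ)⁻¹ K`.
  set L := D.U * diagonal D.σ with hL
  set K := diagonal (fun i => (D.σ i)⁻¹) * D.Uᵀ with hK
  have hR : R = L * D.Vᵀ := D.eq
  have hKL : K * L = 1 := by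
    rw [hK, hL, Matrix.mul_assoc, ← Matrix.mul_assoc D.Uᵀ, D.orthoU, Matrix.one_mul,
      diagonal_mul_diagonal]
    simp [hσ]
  have hLK : L * K = D.U * D.Uᵀ := by
    rw [hK, hL, Matrix.mul_assoc, ← Matrix.mul_assoc (diagonal D.σ), diagonal_mul_diagonal]
    simp [hσ]
  have hW : R * S = L * Y := by
    conv_lhs => rw [hR]
    rw [hYdef, Matrix.mul_assoc]
  have hWY : R * S * (Yᵀ * H⁻¹ * K) = L * K := by
    rw [hW]
    calc L * Y * (Yᵀ * H⁻¹ * K) = L * (Y * Yᵀ * H⁻¹) * K := by simp only [Matrix.mul_assoc]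
      _ = L * K := by rw [← hH, Matrix.mul_nonsing_inv _ hu, Matrix.mul_one]
  have hYW : Yᵀ * H⁻¹ * K * (R * S) = Yᵀ * H⁻¹ * Y := by
    rw [hW]
    calc Yᵀ * H⁻¹ * K * (L * Y) = Yᵀ * H⁻¹ * (K * L) * Y := by simp only [Matrix.mul_assoc]
      _ = _ := by rw [hKL, Matrix.mul_one]
  have hp : pinv (R * S) = Yᵀ * H⁻¹ * K := by
    apply pinv_eq_of_penrose
    · rw [hYW]
      calc Yᵀ * H⁻¹ * Y * (Yᵀ * H⁻¹ * K) = Yᵀ * (H⁻¹ * (Y * Yᵀ)) * H⁻¹ * K := by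
            simp only [Matrix.mul_assoc]
        _ = _ := by rw [← hH, Matrix.nonsing_inv_mul _ hu, Matrix.mul_one]
    · rw [hWY, hLK]; simp
    · rw [hYW]; simp [hHt, Matrix.mul_assoc]
    · rw [hWY, hW, Matrix.mul_assoc, ← Matrix.mul_assoc K, hKL, Matrix.one_mul]
  calc pinv (R * S) * R = Yᵀ * H⁻¹ * K * (L * D.Vᵀ) := by rw [hp, ← hR]
    _ = _ := by rw [Matrix.mul_assoc _ K, ← Matrix.mul_assoc K, hKL, Matrix.one_mul]

end Pinv

/-! ### Sketched regression for a fixed sketch -/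

section Deterministic

variable {a b d e : Type*} [Fintype a] [Fintype b] [Fintype d] [Fintype e]

/-- Row regression: if `P = A - U Y` is orthogonal to the columns of `U`, and the
sketch `S` nearly preserves `Uᵀ U` and `Uᵀ P`, then the rows `Sᵀ A` reproduce `A` almost as well
as the columns of `U` do. -/
theorem exists_row_approx [DecidableEq e] {A : Matrix a b ℝ} {U : Matrix a e ℝ} (hU : Uᵀ * U = 1)
    {Y : Matrix e b ℝ} {P : Matrix a b ℝ} (hA : A = U * Y + P) (hP : Uᵀ * P = 0)
    (S : Matrix a d ℝ) {ε : ℝ}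
    (h1 : frobNorm (Uᵀ * (S * Sᵀ) * U - 1) ≤ 1 / 2)
    (h2 : frobNorm (Uᵀ * (S * Sᵀ) * P) ≤ ε / 2 * frobNorm P) :
    ∃ X : Matrix a d ℝ, frobNorm (A - X * (Sᵀ * A)) ^ 2 ≤ (1 + ε ^ 2) * frobNorm P ^ 2 := by
  set H := Uᵀ * (S * Sᵀ) * U with hH
  have hu := isUnit_det_of_frobNorm_sub_one_le h1
  have hHt : Hᵀ = H := by rw [hH]; simp [Matrix.mul_assoc]
  set N := H⁻¹ * (Uᵀ * (S * Sᵀ) * P) with hN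
  have hNle : frobNorm N ≤ ε * frobNorm P := by
    have h3 := frobNorm_mul_inv_le h1 (Uᵀ * (S * Sᵀ) * P)ᵀ
    have h4 : (Uᵀ * (S * Sᵀ) * P)ᵀ * H⁻¹ = Nᵀ := by
      rw [hN, transpose_mul H⁻¹, transpose_nonsing_inv, hHt]
    rw [h4, frobNorm_transpose, frobNorm_transpose] at h3
    linarith
  refine ⟨U * H⁻¹ * Uᵀ * S, ?_⟩
  -- The sketched solution reproduces `U Y` exactly, and its error `U N` is orthogonal to `P`.
  have key : A - U * H⁻¹ * Uᵀ * S * (Sᵀ * A) = P + -(U * N) := by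
    have h5 : U * H⁻¹ * Uᵀ * S * (Sᵀ * (U * Y)) = U * Y := by
      calc _ = U * (H⁻¹ * (Uᵀ * (S * Sᵀ) * U)) * Y := by simp only [Matrix.mul_assoc]
        _ = _ := by rw [← hH, Matrix.nonsing_inv_mul _ hu, Matrix.mul_one]
    have h6 : U * H⁻¹ * Uᵀ * S * (Sᵀ * P) = U * N := by
      rw [hN]; simp only [Matrix.mul_assoc]
    rw [hA, Matrix.mul_add, Matrix.mul_add, h5, h6]
    abel
  have h7 : frobNorm (U * N) = frobNorm N := by
    rw [← frobNorm_transpose, transpose_mul, frobNorm_mul_transpose_of_ortho hU,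
      frobNorm_transpose]
  have h8 : Pᵀ * (-(U * N)ᵀ)ᵀ = 0 := by
    have : Pᵀ * U = 0 := by simpa using congrArg Matrix.transpose hP
    simp [← Matrix.mul_assoc, this]
  rw [key, ← frobNorm_transpose, transpose_add, transpose_neg,
    frobNorm_sq_add_of_mul_transpose_eq_zero h8, frobNorm_transpose, frobNorm_neg,
    frobNorm_transpose, h7]
  have := pow_le_pow_left₀ (frobNorm_nonneg _) hNle 2
  nlinarith

/-- The projection `A V Vᵀ` onto the row space of `R` is the best approximation of `A` of the
form `X R`. -/
theorem frobNorm_sub_proj_le {R : Matrix d b ℝ} (D : CompactSVD R) (A : Matrix a b ℝ)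
    (X : Matrix a d ℝ) :
    frobNorm (A - A * D.V * D.Vᵀ) ≤ frobNorm (A - X * R) := by
  have h1 : A - X * R = (A - A * D.V * D.Vᵀ) + (A * D.V - X * (D.U * diagonal D.σ)) * D.Vᵀ := by
    conv_lhs => rw [D.eq]
    rw [Matrix.sub_mul]
    simp only [Matrix.mul_assoc]
    abel
  have h2 : (A - A * D.V * D.Vᵀ) * ((A * D.V - X * (D.U * diagonal D.σ)) * D.Vᵀ)ᵀ = 0 := by
    rw [transpose_mul, transpose_transpose, ← Matrix.mul_assoc, Matrix.sub_mul,
      Matrix.mul_assoc (A * D.V), D.orthoV, Matrix.mul_one, sub_self, Matrix.zero_mul]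
  rw [← sq_le_sq₀ (frobNorm_nonneg _) (frobNorm_nonneg _), h1,
    frobNorm_sq_add_of_mul_transpose_eq_zero h2]
  linarith [sq_nonneg (frobNorm ((A * D.V - X * (D.U * diagonal D.σ)) * D.Vᵀ))]

/-- Column regression: with `B = A - A V Vᵀ`, if the sketch `S` nearly preserves `Vᵀ V` and
`B V = 0`, then `A S (R S)† R` is almost as good as the projection onto the row space of `R`. -/
theorem frobNorm_sub_cur_sq_le {R : Matrix d b ℝ} (D : CompactSVD R) (A : Matrix a b ℝ)
    (S : Matrix b e ℝ) {ε : ℝ}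
    (h1 : frobNorm (D.Vᵀ * (S * Sᵀ) * D.V - 1) ≤ 1 / 2)
    (h2 : frobNorm ((A - A * D.V * D.Vᵀ) * (S * Sᵀ) * D.V) ≤
      ε / 2 * frobNorm (A - A * D.V * D.Vᵀ)) :
    frobNorm (A - A * S * pinv (R * S) * R) ^ 2 ≤
      (1 + ε ^ 2) * frobNorm (A - A * D.V * D.Vᵀ) ^ 2 := by
  set B := A - A * D.V * D.Vᵀ with hB
  have hBV : B * D.V = 0 := by
    rw [hB, Matrix.sub_mul, Matrix.mul_assoc (A * D.V), D.orthoV, Matrix.mul_one, sub_self]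
  have hH : D.Vᵀ * S * (D.Vᵀ * S)ᵀ = D.Vᵀ * (S * Sᵀ) * D.V := by
    simp only [transpose_mul, transpose_transpose, Matrix.mul_assoc]
  have hu := isUnit_det_of_frobNorm_sub_one_le h1
  have hp := pinv_mul_eq D S (by rwa [hH])
  rw [hH] at hp
  set H := D.Vᵀ * (S * Sᵀ) * D.V with hHdef
  set N := B * (S * Sᵀ) * D.V * H⁻¹ with hN
  have hNle : frobNorm N ≤ ε * frobNorm B := by
    have := frobNorm_mul_inv_le h1 (B * (S * Sᵀ) * D.V)
    linarith
  -- `A S (R S)† R` reproduces `A V Vᵀ` exactly, and its error `N Vᵀ` is orthogonal to `B`.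
  have key : A - A * S * pinv (R * S) * R = B + (-N) * D.Vᵀ := by
    have hA : A = A * D.V * D.Vᵀ + B := by rw [hB]; abel
    have h5 : A * D.V * D.Vᵀ * (S * ((D.Vᵀ * S)ᵀ * H⁻¹ * D.Vᵀ)) = A * D.V * D.Vᵀ := by
      calc _ = A * D.V * (D.Vᵀ * S * (D.Vᵀ * S)ᵀ * H⁻¹) * D.Vᵀ := by
            simp only [Matrix.mul_assoc]
        _ = _ := by rw [hH, Matrix.mul_nonsing_inv _ hu, Matrix.mul_one]
    have h6 : B * (S * ((D.Vᵀ * S)ᵀ * H⁻¹ * D.Vᵀ)) = N * D.Vᵀ := by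
      rw [hN]
      simp only [transpose_mul, transpose_transpose, Matrix.mul_assoc]
    rw [Matrix.mul_assoc (A * S), hp, Matrix.mul_assoc A]
    calc A - A * (S * ((D.Vᵀ * S)ᵀ * H⁻¹ * D.Vᵀ))
        = A - (A * D.V * D.Vᵀ + B) * (S * ((D.Vᵀ * S)ᵀ * H⁻¹ * D.Vᵀ)) := by rw [← hA]
      _ = A - A * D.V * D.Vᵀ - N * D.Vᵀ := by rw [Matrix.add_mul, h5, h6]; abel
      _ = _ := by rw [Matrix.neg_mul, ← hB, sub_eq_add_neg]
  have h8 : B * ((-N) * D.Vᵀ)ᵀ = 0 := by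
    rw [transpose_mul, transpose_transpose, ← Matrix.mul_assoc, hBV, Matrix.zero_mul]
  rw [key, frobNorm_sq_add_of_mul_transpose_eq_zero h8,
    frobNorm_mul_transpose_of_ortho D.orthoV, frobNorm_neg]
  have := pow_le_pow_left₀ (frobNorm_nonneg _) hNle 2
  nlinarith

theorem topCols_transpose_mul {A : Matrix a b ℝ} (D : CompactSVD A) (k : ℕ) (h : k ≤ A.rank) :
    (topCols k h D.U)ᵀ * A =
      diagonal (fun i => D.σ (Fin.castLE h i)) * (topCols k h D.V)ᵀ := by
  have h1 : (topCols k h D.U)ᵀ * D.U = (1 : Matrix _ _ ℝ).submatrix (Fin.castLE h) id := by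
    rw [← D.orthoU]
    rfl
  have h2 : (topCols k h D.U)ᵀ * A = (topCols k h D.U)ᵀ * (D.U * diagonal D.σ * D.Vᵀ) := by
    rw [← D.eq]
  rw [h2, ← Matrix.mul_assoc, ← Matrix.mul_assoc, h1]
  ext i j
  simp [Matrix.mul_apply, topCols, Matrix.one_apply, diagonal_apply]

/-- The residual `A - A_k` is orthogonal to the top left singular vectors, so that `A_k` solves the
regression of `A` on them. -/
theorem topCols_transpose_mul_sub_trunc {A : Matrix a b ℝ} (D : CompactSVD A) (k : ℕ)
    (h : k ≤ A.rank) : (topCols k h D.U)ᵀ * (A - D.trunc k h) = 0 := by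
  rw [Matrix.mul_sub, topCols_transpose_mul, CompactSVD.trunc, Matrix.mul_assoc (topCols k h D.U),
    ← Matrix.mul_assoc _ (topCols k h D.U), topCols_ortho k h D.U D.orthoU, Matrix.one_mul,
    sub_self]

end Deterministic

/-! ### Independent draws from a finite law -/

section Probability

variable {α : Type}

theorem toOuterMeasure_compl_le (p : PMF α) (s : Set α) {x : ℝ} (hx : 0 ≤ x)
    (h : p.toOuterMeasure sᶜ ≤ ENNReal.ofReal x) :
    ENNReal.ofReal (1 - x) ≤ p.toOuterMeasure s := by
  have h1 : p.toOuterMeasure s + p.toOuterMeasure sᶜ = 1 := by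
    rw [PMF.toOuterMeasure_apply, PMF.toOuterMeasure_apply, ← ENNReal.tsum_add, ← p.tsum_coe]
    refine tsum_congr fun a => ?_
    by_cases ha : a ∈ s <;> simp [ha]
  rw [ENNReal.ofReal_sub _ hx, ENNReal.ofReal_one, ← h1]
  exact tsub_le_iff_right.mpr (add_le_add le_rfl h)

/-- Independent draws all fall into `B` with the product probability. The law `p` need not live on a
finite type, as the outputs of a run do not. -/
theorem toOuterMeasure_iid_forall (p : PMF α) (B : Set α) (N : ℕ) :
    (iid p N).toOuterMeasure {f | ∀ t, f t ∈ B} = p.toOuterMeasure B ^ N := by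
  induction N with
  | zero => simpa [iid] using Subsingleton.elim _ _
  | succ N ih =>
    rw [iid, PMF.toOuterMeasure_bind_apply, pow_succ', PMF.toOuterMeasure_apply p B,
      ← ENNReal.tsum_mul_right]
    refine tsum_congr fun x => ?_
    rw [PMF.toOuterMeasure_map_apply]
    by_cases hx : x ∈ B
    · have : (fun f : Fin N → α => (Fin.cons x f : Fin (N + 1) → α)) ⁻¹' {f | ∀ t, f t ∈ B} =
          {f | ∀ t, f t ∈ B} := by
        ext f
        simp [Fin.forall_fin_succ, hx]
      rw [this, ih, PMF.toOuterMeasure_apply p B]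
      simp [hx]
    · have : (fun f : Fin N → α => (Fin.cons x f : Fin (N + 1) → α)) ⁻¹' {f | ∀ t, f t ∈ B} =
          ∅ := by
        ext f
        simp [Fin.forall_fin_succ, hx]
      rw [this]
      simp [hx]

/-- Failure of a two-stage experiment: either the first stage is in `B`, or the second one fails. -/
theorem toOuterMeasure_bind_le {β : Type} (p : PMF α) (f : α → PMF β) (s : Set β) (B : Set α)
    {x y : ℝ≥0∞} (hB : p.toOuterMeasure B ≤ x)
    (hf : ∀ a, a ∉ B → (f a).toOuterMeasure s ≤ y) :
    (p.bind f).toOuterMeasure s ≤ x + y := by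
  have h1 : ∀ a, p a * (f a).toOuterMeasure s ≤ B.indicator p a + p a * y := by
    intro a
    by_cases ha : a ∈ B
    · rw [Set.indicator_of_mem ha]
      refine le_add_right (mul_le_of_le_one_right' ?_)
      calc (f a).toOuterMeasure s ≤ (f a).toOuterMeasure Set.univ :=
            (f a).toOuterMeasure.mono (Set.subset_univ s)
        _ = 1 := ((f a).toOuterMeasure_apply_eq_one_iff Set.univ).mpr (Set.subset_univ _)
    · exact le_add_left (mul_le_mul_right (hf a ha) (p a))
  rw [PMF.toOuterMeasure_bind_apply]
  refine (ENNReal.tsum_le_tsum h1).trans ?_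
  rw [ENNReal.tsum_add, ENNReal.tsum_mul_right, p.tsum_coe, one_mul, ← PMF.toOuterMeasure_apply]
  exact add_le_add hB le_rfl

variable [Fintype α]

/-- The expectation of a real function on a finite probability space. -/
noncomputable def expect (p : PMF α) (f : α → ℝ) : ℝ := ∑ x, (p x).toReal * f x

theorem sum_toReal (p : PMF α) : ∑ x, (p x).toReal = 1 := by
  rw [← ENNReal.toReal_sum fun x _ => p.apply_ne_top x, ← tsum_fintype (L := .unconditional α),
    p.tsum_coe, ENNReal.toReal_one]

theorem expect_const (p : PMF α) (c : ℝ) : expect p (fun _ => c) = c := by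
  rw [expect, ← Finset.sum_mul, sum_toReal, one_mul]

theorem expect_add (p : PMF α) (f g : α → ℝ) :
    expect p (fun x => f x + g x) = expect p f + expect p g := by
  simp [expect, mul_add, Finset.sum_add_distrib]

theorem expect_mul_left (p : PMF α) (c : ℝ) (f : α → ℝ) :
    expect p (fun x => c * f x) = c * expect p f := by
  rw [expect, expect, Finset.mul_sum]
  exact Finset.sum_congr rfl fun x _ => by ring

theorem expect_sum {ι : Type*} (s : Finset ι) (p : PMF α) (f : ι → α → ℝ) :
    expect p (fun x => ∑ i ∈ s, f i x) = ∑ i ∈ s, expect p (f i) := by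
  simp only [expect, Finset.mul_sum]
  exact Finset.sum_comm

/-- Markov's inequality. For `t = 0` it says that `f` vanishes almost surely. -/
theorem toOuterMeasure_lt_le (p : PMF α) {f : α → ℝ} (hf : ∀ x, 0 ≤ f x) {t q : ℝ} (ht : 0 ≤ t)
    (hq : 0 ≤ q) (h : expect p f ≤ q * t) :
    p.toOuterMeasure {x | t < f x} ≤ ENNReal.ofReal q := by
  classical
  have h0 : p.toOuterMeasure {x | t < f x} =
      ENNReal.ofReal (∑ x, if t < f x then (p x).toReal else 0) := by
    rw [PMF.toOuterMeasure_apply_fintype,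
      ENNReal.ofReal_sum_of_nonneg fun x _ => by split_ifs <;> positivity]
    refine Finset.sum_congr rfl fun x _ => ?_
    by_cases hx : t < f x <;> simp [hx, ENNReal.ofReal_toReal (p.apply_ne_top x)]
  rw [h0]
  apply ENNReal.ofReal_le_ofReal
  rcases ht.eq_or_lt with rfl | ht
  · have h1 : expect p f = 0 := le_antisymm (by simpa using h)
      (Finset.sum_nonneg fun x _ => mul_nonneg ENNReal.toReal_nonneg (hf x))
    have h2 := (Finset.sum_eq_zero_iff_of_nonneg
      fun x _ => mul_nonneg ENNReal.toReal_nonneg (hf x)).mp h1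
    refine (Finset.sum_eq_zero fun x hx => ?_).trans_le hq
    split_ifs with hfx
    · exact (mul_eq_zero.mp (h2 x hx)).resolve_right hfx.ne'
    · rfl
  · refine le_of_mul_le_mul_right (le_trans ?_ h) ht
    rw [Finset.sum_mul]
    refine Finset.sum_le_sum fun x _ => ?_
    split_ifs with hfx
    · exact mul_le_mul_of_nonneg_left hfx.le ENNReal.toReal_nonneg
    · rw [zero_mul]
      exact mul_nonneg ENNReal.toReal_nonneg (hf x)

theorem expect_iid_succ (p : PMF α) (N : ℕ) (f : (Fin (N + 1) → α) → ℝ) :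
    expect (iid p (N + 1)) f = expect p fun x => expect (iid p N) fun h => f (Fin.cons x h) := by
  classical
  have h1 : ∀ x (h : Fin N → α), iid p (N + 1) (Fin.cons x h) = p x * iid p N h := by
    intro x h
    rw [iid, PMF.bind_apply, tsum_fintype, Finset.sum_eq_single x]
    · rw [PMF.map_apply, tsum_fintype, Finset.sum_eq_single h]
      · simp
      · intro h' _ hne
        rw [if_neg]
        intro he
        exact hne (Fin.cons_right_injective (α := fun _ => α) x he).symm
      · simp
    · intro y _ hne
      rw [PMF.map_apply, tsum_fintype, Finset.sum_eq_zero, mul_zero]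
      intro h' _
      rw [if_neg]
      intro he
      exact hne (congrFun he 0).symm
    · simp
  rw [expect, ← (Fin.consEquiv fun _ : Fin (N + 1) => α).sum_comp, Fintype.sum_prod_type]
  simp only [expect, Finset.mul_sum]
  refine Finset.sum_congr rfl fun x _ => Finset.sum_congr rfl fun h _ => ?_
  rw [← mul_assoc, ← ENNReal.toReal_mul, ← h1]
  rfl

/-- Mean and second moment of a sum of independent centered variables. -/
theorem expect_iid_sum (p : PMF α) (Y : α → ℝ) (hY : expect p Y = 0) (N : ℕ) :
    expect (iid p N) (fun h => ∑ t, Y (h t)) = 0 ∧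
      expect (iid p N) (fun h => (∑ t, Y (h t)) ^ 2) = N * expect p (fun x => Y x ^ 2) := by
  induction N with
  | zero => simp [expect]
  | succ N ih =>
    obtain ⟨ih1, ih2⟩ := ih
    constructor
    · rw [expect_iid_succ]
      simp only [Fin.sum_univ_succ, Fin.cons_zero, Fin.cons_succ, expect_add, expect_const, ih1,
        hY, add_zero]
    · rw [expect_iid_succ]
      have h1 : ∀ x, expect (iid p N) (fun h => (∑ t, Y ((Fin.cons x h : Fin (N + 1) → α) t)) ^ 2)
          = Y x ^ 2 + N * expect p (fun x => Y x ^ 2) := by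
        intro x
        have h2 : ∀ h : Fin N → α, (∑ t, Y ((Fin.cons x h : Fin (N + 1) → α) t)) ^ 2 =
            Y x ^ 2 + (2 * Y x * (∑ t, Y (h t)) + (∑ t, Y (h t)) ^ 2) := by
          intro h
          simp only [Fin.sum_univ_succ, Fin.cons_zero, Fin.cons_succ]
          ring
        simp only [h2, expect_add, expect_const, expect_mul_left, ih1, ih2]
        ring
      simp only [h1, expect_add, expect_const]
      push_cast
      ring

/-- The importance sampling estimate of a sum from `N` independent draws has variance at most
`N⁻¹ ∑ z_i² / p_i`. -/
theorem expect_iid_importance_le (p : PMF α) {N : ℕ} (hN : 0 < N) (z : α → ℝ)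
    (hz : ∀ x, (p x).toReal = 0 → z x = 0) :
    expect (iid p N) (fun h => (∑ t, z (h t) / (N * (p (h t)).toReal) - ∑ x, z x) ^ 2) ≤
      (∑ x, z x ^ 2 / (p x).toReal) / N := by
  have hN' : (N : ℝ) ≠ 0 := by positivity
  set μ := ∑ x, z x with hμ
  set Y : α → ℝ := fun x => z x / (N * (p x).toReal) - μ / N with hYd
  have h1 : expect p (fun x => z x / (N * (p x).toReal)) = μ / N := by
    rw [expect, hμ, Finset.sum_div]
    refine Finset.sum_congr rfl fun x _ => ?_
    by_cases hx : (p x).toReal = 0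
    · simp [hz x hx]
    · field_simp
  have hY : expect p Y = 0 := by
    have h2 : Y = fun x => z x / (N * (p x).toReal) + -(μ / N) :=
      funext fun x => sub_eq_add_neg _ _
    rw [h2, expect_add, expect_const, h1, add_neg_cancel]
  have h3 : ∀ h : Fin N → α, ∑ t, z (h t) / (N * (p (h t)).toReal) - μ = ∑ t, Y (h t) := by
    intro h
    simp only [hYd, Finset.sum_sub_distrib, Finset.sum_const, Finset.card_univ, Fintype.card_fin,
      nsmul_eq_mul]
    field_simp
  simp only [h3]
  rw [(expect_iid_sum p Y hY N).2]
  have h4 : ∀ x, Y x ^ 2 = (z x / (N * (p x).toReal)) ^ 2 +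
      (-(2 * (μ / N)) * (z x / (N * (p x).toReal)) + (μ / N) ^ 2) := fun x => by
    simp only [hYd]; ring
  have h5 : expect p (fun x => (z x / (N * (p x).toReal)) ^ 2) =
      (∑ x, z x ^ 2 / (p x).toReal) / N ^ 2 := by
    rw [expect, Finset.sum_div]
    refine Finset.sum_congr rfl fun x _ => ?_
    by_cases hx : (p x).toReal = 0
    · simp [hx]
    · field_simp
  have h6 : expect p (fun x => Y x ^ 2) ≤ (∑ x, z x ^ 2 / (p x).toReal) / N ^ 2 := by
    simp only [h4, expect_add, expect_const, expect_mul_left, h1, h5]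
    nlinarith [sq_nonneg (μ / N)]
  calc (N : ℝ) * expect p (fun x => Y x ^ 2)
      ≤ N * ((∑ x, z x ^ 2 / (p x).toReal) / N ^ 2) := by gcongr
    _ = _ := by field_simp

/-- Approximate matrix multiplication by importance sampling: the matrix version of
`expect_iid_importance_le`, in the Frobenius norm. -/
theorem expect_iid_matrix_le {a b : Type*} [Fintype a] [Fintype b] (p : PMF α) {N : ℕ}
    (hN : 0 < N) (X : α → Matrix a b ℝ) (hX : ∀ x, (p x).toReal = 0 → X x = 0) :
    expect (iid p N) (fun h =>
        frobNorm (∑ t, (1 / (N * (p (h t)).toReal)) • X (h t) - ∑ x, X x) ^ 2) ≤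
      (∑ x, frobNorm (X x) ^ 2 / (p x).toReal) / N := by
  have h1 : ∀ h : Fin N → α,
      frobNorm (∑ t, (1 / (N * (p (h t)).toReal)) • X (h t) - ∑ x, X x) ^ 2 =
      ∑ i, ∑ j, (∑ t, X (h t) i j / (N * (p (h t)).toReal) - ∑ x, X x i j) ^ 2 := by
    intro h
    rw [frobNorm_sq]
    simp [Matrix.sum_apply, div_eq_inv_mul]
  simp only [h1, expect_sum]
  have h2 : (∑ x, frobNorm (X x) ^ 2 / (p x).toReal) / N =
      ∑ i, ∑ j, (∑ x, X x i j ^ 2 / (p x).toReal) / N := by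
    simp only [frobNorm_sq, Finset.sum_div]
    rw [Finset.sum_comm]
    exact Finset.sum_congr rfl fun i _ => Finset.sum_comm
  rw [h2]
  exact Finset.sum_le_sum fun i _ => Finset.sum_le_sum fun j _ =>
    expect_iid_importance_le p hN (fun x => X x i j) fun x hx => by simp [hX x hx]

end Probability

/-! ### Sampling rows by leverage scores -/

section RowSampling

theorem rowProb_nonneg {m q : ℕ} (U : Matrix (Fin m) (Fin q) ℝ) (i : Fin m) :
    0 ≤ rowProb U i := by
  unfold rowProb rowLeverage
  positivity

theorem rowPMF_toReal {m q : ℕ} (hq : 0 < q) (U : Matrix (Fin m) (Fin q) ℝ) (hU : Uᵀ * U = 1)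
    (i : Fin m) : (rowPMF hq U hU i).toReal = rowProb U i := by
  rw [rowPMF, PMF.ofFintype_apply, ENNReal.toReal_ofReal (rowProb_nonneg U i)]

theorem frobNorm_vecMulVec_sq {a b : Type*} [Fintype a] [Fintype b] (u : a → ℝ) (v : b → ℝ) :
    frobNorm (vecMulVec u v) ^ 2 = (∑ i, u i ^ 2) * ∑ j, v j ^ 2 := by
  simp [frobNorm_sq, vecMulVec_apply, mul_pow, Finset.sum_mul_sum]

theorem mul_rowSampling_mul {m r : ℕ} {a b : Type*} [Fintype a] [Fintype b]
    (U : Matrix (Fin m) a ℝ) (Q : Matrix (Fin m) b ℝ) {p : Fin m → ℝ} (hp : ∀ i, 0 ≤ p i)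
    (i : Fin r → Fin m) :
    Uᵀ * (rowSampling p i * (rowSampling p i)ᵀ) * Q =
      ∑ t, (1 / (r * p (i t))) • vecMulVec (U (i t)) (Q (i t)) := by
  rw [← Matrix.mul_assoc, Matrix.mul_assoc]
  ext x y
  rw [Matrix.mul_apply, Matrix.sum_apply]
  refine Finset.sum_congr rfl fun t _ => ?_
  have h1 : (Uᵀ * rowSampling p i) x t = U (i t) x * (1 / √(r * p (i t))) := by
    simp [Matrix.mul_apply, rowSampling]
  have h2 : ((rowSampling p i)ᵀ * Q) t y = 1 / √(r * p (i t)) * Q (i t) y := by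
    simp [Matrix.mul_apply, rowSampling]
  have h3 : 1 / √(r * p (i t)) * (1 / √(r * p (i t))) = 1 / (r * p (i t)) := by
    rw [div_mul_div_comm, one_mul, Real.mul_self_sqrt (mul_nonneg (Nat.cast_nonneg r) (hp _))]
  rw [h1, h2, Matrix.smul_apply, vecMulVec_apply, smul_eq_mul, ← h3]
  ring

/-- Sampling rows by the leverage scores of `U` approximates every product `Uᵀ Q`. -/
theorem expect_rowSampling_le {m q r : ℕ} {b : Type*} [Fintype b] (hq : 0 < q) (hr : 0 < r)
    (U : Matrix (Fin m) (Fin q) ℝ) (hU : Uᵀ * U = 1) (Q : Matrix (Fin m) b ℝ) :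
    expect (iid (rowPMF hq U hU) r) (fun i => frobNorm (Uᵀ *
        (rowSampling (rowProb U) i * (rowSampling (rowProb U) i)ᵀ) * Q - Uᵀ * Q) ^ 2) ≤
      q * frobNorm Q ^ 2 / r := by
  have hsum : ∑ x, vecMulVec (U x) (Q x) = Uᵀ * Q := by
    ext i j
    simp [Matrix.sum_apply, vecMulVec_apply, Matrix.mul_apply]
  have hq' : (q : ℝ) ≠ 0 := by positivity
  have hX : ∀ x, rowProb U x = 0 → vecMulVec (U x) (Q x) = 0 := by
    intro x hx
    have h1 : ∑ l, U x l ^ 2 = 0 := by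
      simpa [rowProb, rowLeverage, hq'] using hx
    have h2 := (Finset.sum_eq_zero_iff_of_nonneg fun l _ => sq_nonneg (U x l)).mp h1
    ext l j
    simp [vecMulVec_apply, pow_eq_zero_iff two_ne_zero |>.mp (h2 l (Finset.mem_univ l))]
  have h := expect_iid_matrix_le (rowPMF hq U hU) hr (fun x => vecMulVec (U x) (Q x))
    (fun x hx => hX x (by rwa [rowPMF_toReal] at hx))
  simp only [rowPMF_toReal, hsum] at h
  simp only [mul_rowSampling_mul U Q (rowProb_nonneg U)]
  refine h.trans ?_
  rw [frobNorm_sq Q, Finset.mul_sum]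
  gcongr with x
  rw [frobNorm_vecMulVec_sq]
  by_cases hx : rowProb U x = 0
  · rw [hx, div_zero]
    positivity
  · have h3 : ∑ l, U x l ^ 2 = q * rowProb U x := by
      unfold rowProb rowLeverage
      field_simp
    rw [h3]
    apply le_of_eq
    field_simp

end RowSampling

/-! ### Sampling blocks of columns by leverage scores -/

section BlockSampling

variable {n s : ℕ}

theorem blockProb_nonneg {q : ℕ} (V : Matrix (Fin n) (Fin q) ℝ) (i : Fin (n ⌈/⌉ s)) :
    0 ≤ blockProb s V i := by
  unfold blockProb blockLeverage
  positivity

theorem blockPMF_toReal {q : ℕ} (hs : 0 < s) (hq : 0 < q) (V : Matrix (Fin n) (Fin q) ℝ)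
    (hV : Vᵀ * V = 1) (i : Fin (n ⌈/⌉ s)) :
    (blockPMF hs hq V hV i).toReal = blockProb s V i := by
  rw [blockPMF, PMF.ofFintype_apply, ENNReal.toReal_ofReal (blockProb_nonneg V i)]

theorem sum_blockSel_mul_transpose (hs : 0 < s) :
    ∑ i, blockSel n s i * (blockSel n s i)ᵀ = 1 := by
  ext j j'
  rw [Matrix.sum_apply, ← sum_block_position hs j ((1 : Matrix (Fin n) (Fin n) ℝ) j j')]
  refine Finset.sum_congr rfl fun i _ => ?_
  rw [Matrix.mul_apply]
  refine Finset.sum_congr rfl fun l _ => ?_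
  by_cases h : (j : ℕ) = i * s + l
  · simp [blockSel, ← h, Matrix.one_apply, Fin.ext_iff, eq_comm]
  · simp [blockSel, h]

theorem sum_frobNorm_mul_blockSel_sq {d : ℕ} (hs : 0 < s) (P : Matrix (Fin d) (Fin n) ℝ) :
    ∑ i, frobNorm (P * blockSel n s i) ^ 2 = frobNorm P ^ 2 := by
  have h := sum_blockLeverage hs Pᵀ
  simp only [blockLeverage, transpose_transpose] at h
  rw [h, frobNorm_sq, Finset.sum_comm]
  rfl

theorem mul_blockSampling_mul {g : ℕ} {a b : Type} [Fintype a] [Fintype b]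
    (P : Matrix a (Fin n) ℝ) (V : Matrix (Fin n) b ℝ) {p : Fin (n ⌈/⌉ s) → ℝ}
    (hp : ∀ i, 0 ≤ p i) (j : Fin g → Fin (n ⌈/⌉ s)) :
    P * (blockSampling p j * (blockSampling p j)ᵀ) * V =
      ∑ t, (1 / (g * p (j t))) • ((P * blockSel n s (j t)) * (Vᵀ * blockSel n s (j t))ᵀ) := by
  have h0 : P * (blockSampling p j * (blockSampling p j)ᵀ) * V =
      (P * blockSampling p j) * (Vᵀ * blockSampling p j)ᵀ := by
    simp [Matrix.mul_assoc]
  have h1 : ∀ {e : Type} (M : Matrix e (Fin n) ℝ) x t l, (M * blockSampling p j) x (t, l) =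
      (M * blockSel n s (j t)) x l * (1 / √(g * p (j t))) := by
    intro e M x t l
    simp [Matrix.mul_apply, blockSampling, Finset.sum_mul, div_eq_mul_inv, mul_assoc]
  rw [h0]
  ext x y
  rw [Matrix.mul_apply, Fintype.sum_prod_type, Matrix.sum_apply]
  refine Finset.sum_congr rfl fun t _ => ?_
  have h3 : 1 / √(g * p (j t)) * (1 / √(g * p (j t))) = 1 / (g * p (j t)) := by
    rw [div_mul_div_comm, one_mul, Real.mul_self_sqrt (mul_nonneg (Nat.cast_nonneg g) (hp _))]
  rw [Matrix.smul_apply, Matrix.mul_apply, smul_eq_mul, Finset.mul_sum, ← h3]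
  refine Finset.sum_congr rfl fun l _ => ?_
  rw [transpose_apply, transpose_apply, h1, h1]
  ring

variable {q : ℕ} (V : Matrix (Fin n) (Fin q) ℝ)

theorem blockStableRank_nonneg : 0 ≤ blockStableRank s V :=
  Real.iInf_nonneg fun _ => by positivity

open scoped Matrix.Norms.L2Operator in
theorem blockStableRank_mul_le (i : Fin (n ⌈/⌉ s)) :
    blockStableRank s V * specNorm (Vᵀ * blockSel n s i) ^ 2 ≤
      frobNorm (Vᵀ * blockSel n s i) ^ 2 := by
  by_cases h : Vᵀ * blockSel n s i = 0
  · have h0 : specNorm (0 : Matrix (Fin q) (Fin s) ℝ) = 0 := norm_zero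
    rw [h, h0]
    simpa using sq_nonneg _
  · have h1 : 0 < specNorm (Vᵀ * blockSel n s i) ^ 2 := by
      have := specNorm_ne_zero h
      positivity
    rw [← le_div_iff₀ h1]
    exact ciInf_le (f := fun i : {i : Fin (n ⌈/⌉ s) // Vᵀ * blockSel n s i ≠ 0} =>
      frobNorm (Vᵀ * blockSel n s i.1) ^ 2 / specNorm (Vᵀ * blockSel n s i.1) ^ 2)
      ⟨0, by rintro _ ⟨i, rfl⟩; positivity⟩ ⟨i, h⟩

/-- The minimum defining the block stable rank is attained: at least one block meets the column
space of `V`. -/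
theorem exists_eq_blockStableRank (hs : 0 < s) (hq : 0 < q) (hV : Vᵀ * V = 1) :
    ∃ i, Vᵀ * blockSel n s i ≠ 0 ∧ blockStableRank s V =
      frobNorm (Vᵀ * blockSel n s i) ^ 2 / specNorm (Vᵀ * blockSel n s i) ^ 2 := by
  have hne : Nonempty {i : Fin (n ⌈/⌉ s) // Vᵀ * blockSel n s i ≠ 0} := by
    by_contra hcon
    have h0 : ∀ i, Vᵀ * blockSel n s i = 0 := fun i => by
      by_contra hi
      exact hcon ⟨⟨i, hi⟩⟩
    have h1 := sum_blockLeverage hs V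
    rw [sum_sq_of_ortho V hV] at h1
    have h2 : (q : ℝ) = 0 := by rw [← h1]; simp [blockLeverage, h0, frobNorm]
    exact hq.ne' (by exact_mod_cast h2)
  obtain ⟨i, hi⟩ := exists_eq_ciInf_of_finite
    (f := fun i : {i : Fin (n ⌈/⌉ s) // Vᵀ * blockSel n s i ≠ 0} =>
      frobNorm (Vᵀ * blockSel n s i.1) ^ 2 / specNorm (Vᵀ * blockSel n s i.1) ^ 2)
  exact ⟨i.1, i.2, hi.symm⟩

theorem blockStableRank_pos (hs : 0 < s) (hq : 0 < q) (hV : Vᵀ * V = 1) :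
    0 < blockStableRank s V := by
  obtain ⟨i, hi, h⟩ := exists_eq_blockStableRank V hs hq hV
  have h1 := specNorm_ne_zero hi
  have h2 := mt frobNorm_eq_zero.mp hi
  rw [h]
  positivity

theorem blockStableRank_le (hs : 0 < s) (hq : 0 < q) (hV : Vᵀ * V = 1) :
    blockStableRank s V ≤ q := by
  obtain ⟨i, hi, h⟩ := exists_eq_blockStableRank V hs hq hV
  have h1 := specNorm_ne_zero hi
  rw [h, div_le_iff₀ (by positivity)]
  simpa using frobNorm_sq_le_card_mul_specNorm_sq (Vᵀ * blockSel n s i)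

/-- Sampling blocks of columns by the block leverage scores of `V` approximates every product
`P V`. The block stable rank enters through `‖P Eᵢ (Vᵀ Eᵢ)ᵀ‖_F ≤ ‖P Eᵢ‖_F ‖Vᵀ Eᵢ‖₂`. -/
theorem expect_blockSampling_le {g d : ℕ} (hs : 0 < s) (hq : 0 < q) (hV : Vᵀ * V = 1)
    (hg : 0 < g) (P : Matrix (Fin d) (Fin n) ℝ) :
    expect (iid (blockPMF hs hq V hV) g) (fun j => frobNorm (P *
        (blockSampling (blockProb s V) j * (blockSampling (blockProb s V) j)ᵀ) * V - P * V) ^ 2) ≤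
      q / blockStableRank s V * frobNorm P ^ 2 / g := by
  set X : Fin (n ⌈/⌉ s) → Matrix (Fin d) (Fin q) ℝ := fun i =>
    (P * blockSel n s i) * (Vᵀ * blockSel n s i)ᵀ with hXdef
  have hsum : ∑ i, X i = P * V := by
    have h1 : ∀ i, X i = P * (blockSel n s i * (blockSel n s i)ᵀ) * V := fun i => by
      simp only [hXdef, transpose_mul, transpose_transpose, Matrix.mul_assoc]
    simp only [h1]
    rw [← Matrix.sum_mul, ← Matrix.mul_sum, sum_blockSel_mul_transpose hs, Matrix.mul_one]
  have hq' : (q : ℝ) ≠ 0 := by positivity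
  have hα := blockStableRank_pos V hs hq hV
  have hlev : ∀ i, frobNorm (Vᵀ * blockSel n s i) ^ 2 = q * blockProb s V i := fun i => by
    unfold blockProb blockLeverage
    field_simp
  have hX : ∀ i, blockProb s V i = 0 → X i = 0 := by
    intro i hi
    have h1 := hlev i
    rw [hi, mul_zero, pow_eq_zero_iff two_ne_zero, frobNorm_eq_zero] at h1
    simp only [hXdef, h1, transpose_zero, Matrix.mul_zero]
  have h := expect_iid_matrix_le (blockPMF hs hq V hV) hg X
    (fun x hx => hX x (by rwa [blockPMF_toReal] at hx))
  simp only [blockPMF_toReal, hsum] at h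
  simp only [mul_blockSampling_mul P V (blockProb_nonneg V)]
  refine h.trans ?_
  rw [← sum_frobNorm_mul_blockSel_sq hs P, Finset.mul_sum]
  gcongr with i
  by_cases hi : blockProb s V i = 0
  · rw [hi, div_zero]
    positivity
  · have hpos : 0 < blockProb s V i := (blockProb_nonneg V i).lt_of_ne' hi
    have h1 := frobNorm_mul_transpose_sq_le (P * blockSel n s i) (Vᵀ * blockSel n s i)
    have h2 := blockStableRank_mul_le V i
    rw [hlev] at h2
    have h3 : specNorm (Vᵀ * blockSel n s i) ^ 2 ≤
        q * blockProb s V i / blockStableRank s V := by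
      rw [le_div_iff₀ hα]
      linarith
    rw [div_le_iff₀ hpos]
    refine h1.trans ((mul_le_mul_of_nonneg_left h3 (sq_nonneg _)).trans (le_of_eq ?_))
    ring

end BlockSampling

/-! ### One run of the algorithm -/

section Algorithm

variable {m n s k r : ℕ}

/-- With probability at least `5/6` the sampled rows span a good approximation of `A`. -/
theorem toOuterMeasure_rows_bad_le (hk : 0 < k) {A : Matrix (Fin m) (Fin n) ℝ}
    (D : CompactSVD A) (hkA : k ≤ A.rank) {ε : ℝ} (hε : 0 < ε) (hε1 : ε < 1)
    (hr : 48 * ((k : ℝ) ^ 2 / ε ^ 2) ≤ r) :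
    (iid (rowPMF hk (topCols k hkA D.U) (topCols_ortho k hkA D.U D.orthoU)) r).toOuterMeasure
      {i | ¬ ∃ X : Matrix (Fin m) (Fin r) ℝ,
        frobNorm (A - X * ((rowSampling (rowProb (topCols k hkA D.U)) i)ᵀ * A)) ^ 2 ≤
          (1 + ε ^ 2) * frobNorm (A - D.trunc k hkA) ^ 2} ≤ ENNReal.ofReal (1 / 6) := by
  set U := topCols k hkA D.U with hUdef
  have hU : Uᵀ * U = 1 := topCols_ortho k hkA D.U D.orthoU
  set P := A - D.trunc k hkA with hP
  have hUP : Uᵀ * P = 0 := topCols_transpose_mul_sub_trunc D k hkA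
  have hAdec : A = U * (diagonal (fun i => D.σ (Fin.castLE hkA i)) * (topCols k hkA D.V)ᵀ) + P := by
    rw [hP, CompactSVD.trunc, ← Matrix.mul_assoc]
    abel
  have hk1 : (1 : ℝ) ≤ k := by exact_mod_cast hk
  have hrε : 48 * (k : ℝ) ^ 2 ≤ r * ε ^ 2 := by
    rwa [← mul_div_assoc, div_le_iff₀ (by positivity)] at hr
  have hε2 : ε ^ 2 ≤ 1 := by nlinarith
  have hr0 : (0 : ℝ) < r := lt_of_lt_of_le (by positivity) hr
  have hr0' : 0 < r := by exact_mod_cast hr0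
  set S : (Fin r → Fin m) → Matrix (Fin m) (Fin r) ℝ := rowSampling (rowProb U) with hS
  have e1 := expect_rowSampling_le hk hr0' U hU U
  have e2 := expect_rowSampling_le hk hr0' U hU P
  rw [hU, frobNorm_sq U, sum_sq_of_ortho U hU] at e1
  simp only [hUP, sub_zero] at e2
  have b1 := toOuterMeasure_lt_le (iid (rowPMF hk U hU) r) (t := 1 / 4) (q := 1 / 12)
    (fun i => sq_nonneg _) (by norm_num) (by norm_num) (e1.trans (by
      rw [div_le_iff₀ hr0]
      nlinarith))
  have b2 := toOuterMeasure_lt_le (iid (rowPMF hk U hU) r) (t := (ε / 2 * frobNorm P) ^ 2)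
    (q := 1 / 12) (fun i => sq_nonneg _) (sq_nonneg _) (by norm_num) (e2.trans (by
      rw [div_le_iff₀ hr0]
      have : (k : ℝ) ≤ r * ε ^ 2 / 48 := by nlinarith
      nlinarith [mul_le_mul_of_nonneg_right this (sq_nonneg (frobNorm P))]))
  have hsplit : ENNReal.ofReal (1 / 6) = ENNReal.ofReal (1 / 12) + ENNReal.ofReal (1 / 12) := by
    rw [← ENNReal.ofReal_add (by norm_num) (by norm_num)]
    norm_num
  rw [hsplit]
  refine le_trans (MeasureTheory.OuterMeasure.mono _ ?_)
    ((MeasureTheory.measure_union_le _ _).trans (add_le_add b1 b2))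
  intro i hi
  by_contra hcon
  simp only [Set.mem_union, Set.mem_ofPred_eq, not_or, not_lt] at hcon
  refine hi (exists_row_approx hU hAdec hUP (S i) (ε := ε) ?_ ?_)
  · refine le_of_sq_le_sq (hcon.1.trans (by norm_num)) (by norm_num)
  · exact le_of_sq_le_sq hcon.2 (mul_nonneg (by positivity) (frobNorm_nonneg _))

/-- For given rows `R`, with probability at least `5/6` the sampled columns lose only a factor
`√(1 + ε²)` against the projection onto the row space of `R`. -/
theorem toOuterMeasure_blocks_bad_le (hs : 0 < s) (A : Matrix (Fin m) (Fin n) ℝ)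
    {R : Matrix (Fin r) (Fin n) ℝ} (D : CompactSVD R) (hR : 0 < R.rank) {ε : ℝ} (hε : 0 < ε)
    (hε1 : ε < 1) {g : ℕ} (hg : 48 * ((r : ℝ) ^ 2 / (blockStableRank s D.V * ε ^ 2)) ≤ g) :
    (iid (blockPMF hs hR D.V D.orthoV) g).toOuterMeasure
      {j | (1 + ε ^ 2) * frobNorm (A - A * D.V * D.Vᵀ) ^ 2 <
        frobNorm (A - A * blockSampling (blockProb s D.V) j *
          pinv (R * blockSampling (blockProb s D.V) j) * R) ^ 2} ≤ ENNReal.ofReal (1 / 6) := by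
  set B := A - A * D.V * D.Vᵀ with hB
  have hBV : B * D.V = 0 := by
    rw [hB, Matrix.sub_mul, Matrix.mul_assoc (A * D.V), D.orthoV, Matrix.mul_one, sub_self]
  have hα := blockStableRank_pos D.V hs hR D.orthoV
  set α := blockStableRank s D.V with hαdef
  have hρ : (1 : ℝ) ≤ R.rank := by exact_mod_cast hR
  have hρr : (R.rank : ℝ) ≤ r := by
    have := R.rank_le_card_height
    rw [Fintype.card_fin] at this
    exact_mod_cast this
  have hgε : 48 * (r : ℝ) ^ 2 ≤ g * (α * ε ^ 2) := by
    rwa [← mul_div_assoc, div_le_iff₀ (by positivity)] at hg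
  have hε2 : ε ^ 2 ≤ 1 := by nlinarith
  have hr0 : (0 : ℝ) < r := by linarith
  have hg0 : (0 : ℝ) < g := lt_of_lt_of_le (by positivity) hg
  have hg0' : 0 < g := by exact_mod_cast hg0
  have hρ2 : (R.rank : ℝ) ^ 2 ≤ r ^ 2 := by gcongr
  have e1 := expect_blockSampling_le D.V hs hR D.orthoV hg0' D.Vᵀ
  have e2 := expect_blockSampling_le D.V hs hR D.orthoV hg0' B
  rw [D.orthoV, frobNorm_transpose, frobNorm_sq D.V, sum_sq_of_ortho D.V D.orthoV] at e1
  simp only [hBV, sub_zero] at e2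
  rw [← hαdef] at e1 e2
  have b1 := toOuterMeasure_lt_le (iid (blockPMF hs hR D.V D.orthoV) g) (t := 1 / 4) (q := 1 / 12)
    (fun i => sq_nonneg _) (by norm_num) (by norm_num) (e1.trans (by
      rw [div_le_iff₀ hg0, div_mul_eq_mul_div, div_le_iff₀ hα]
      nlinarith [mul_le_mul_of_nonneg_left hε2 (mul_pos hg0 hα).le]))
  have b2 := toOuterMeasure_lt_le (iid (blockPMF hs hR D.V D.orthoV) g)
    (t := (ε / 2 * frobNorm B) ^ 2)
    (q := 1 / 12) (fun i => sq_nonneg _) (sq_nonneg _) (by norm_num) (e2.trans (by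
      rw [div_le_iff₀ hg0, div_mul_eq_mul_div, div_le_iff₀ hα]
      have : (R.rank : ℝ) ≤ g * (α * ε ^ 2) / 48 := by nlinarith
      nlinarith [mul_le_mul_of_nonneg_right this (sq_nonneg (frobNorm B))]))
  have hsplit : ENNReal.ofReal (1 / 6) = ENNReal.ofReal (1 / 12) + ENNReal.ofReal (1 / 12) := by
    rw [← ENNReal.ofReal_add (by norm_num) (by norm_num)]
    norm_num
  rw [hsplit]
  refine le_trans (MeasureTheory.OuterMeasure.mono _ ?_)
    ((MeasureTheory.measure_union_le _ _).trans (add_le_add b1 b2))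
  intro j hj
  by_contra hcon
  simp only [Set.mem_union, Set.mem_ofPred_eq, not_or, not_lt] at hcon
  refine (Set.mem_ofPred_eq ▸ hj : _ < _).not_ge
    (frobNorm_sub_cur_sq_le D A (blockSampling (blockProb s D.V) j) ?_ ?_)
  · exact le_of_sq_le_sq (hcon.1.trans (by norm_num)) (by norm_num)
  · exact le_of_sq_le_sq hcon.2 (mul_nonneg (by positivity) (frobNorm_nonneg _))

/-- One run fails with probability at most `1/3`. -/
theorem toOuterMeasure_run_bad_le (hs : 0 < s) (hk : 0 < k) {A : Matrix (Fin m) (Fin n) ℝ}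
    (D : CompactSVD A) (hkA : k ≤ A.rank)
    (svd : (R : Matrix (Fin r) (Fin n) ℝ) → CompactSVD R)
    (g : Matrix (Fin r) (Fin n) ℝ → ℕ) {ε : ℝ} (hε : 0 < ε) (hε1 : ε < 1)
    (hr : 48 * ((k : ℝ) ^ 2 / ε ^ 2) ≤ r)
    (hg : ∀ R, 48 * ((r : ℝ) ^ 2 / (blockStableRank s (svd R).V * ε ^ 2)) ≤ g R) :
    (run hs hk D hkA svd g).toOuterMeasure
      {X | (1 + ε) * frobNorm (A - D.trunc k hkA) < X.err A} ≤ ENNReal.ofReal (1 / 3) := by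
  have hsplit : ENNReal.ofReal (1 / 3) = ENNReal.ofReal (1 / 6) + ENNReal.ofReal (1 / 6) := by
    rw [← ENNReal.ofReal_add (by norm_num) (by norm_num)]
    norm_num
  rw [hsplit]
  refine toOuterMeasure_bind_le _ _ _ _ (toOuterMeasure_rows_bad_le hk D hkA hε hε1 hr) ?_
  intro i hi
  obtain ⟨X, hX⟩ := not_not.mp hi
  set R := (rowSampling (rowProb (topCols k hkA D.U)) i)ᵀ * A with hR
  have hP := frobNorm_nonneg (A - D.trunc k hkA)
  -- Since `ε < 1`, both factors `1 + ε²` are at most `1 + ε`.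
  have hε2 : 1 + ε ^ 2 ≤ 1 + ε := by nlinarith
  have hproj := frobNorm_sub_proj_le (svd R) A X
  have hB : frobNorm (A - A * (svd R).V * (svd R).Vᵀ) ^ 2 ≤
      (1 + ε) * frobNorm (A - D.trunc k hkA) ^ 2 :=
    (pow_le_pow_left₀ (frobNorm_nonneg _) hproj 2).trans
      (hX.trans (mul_le_mul_of_nonneg_right hε2 (sq_nonneg _)))
  have hfin : ∀ x : ℝ, x ^ 2 ≤ (1 + ε ^ 2) * frobNorm (A - A * (svd R).V * (svd R).Vᵀ) ^ 2 →
      x ≤ (1 + ε) * frobNorm (A - D.trunc k hkA) := by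
    intro x hx
    refine le_of_sq_le_sq (hx.trans ?_) (by positivity)
    calc _ ≤ (1 + ε) * ((1 + ε) * frobNorm (A - D.trunc k hkA) ^ 2) := by gcongr
      _ = _ := by ring
  dsimp only
  split_ifs with hrank
  · rw [PMF.toOuterMeasure_map_apply]
    refine le_trans (MeasureTheory.OuterMeasure.mono _ ?_)
      (toOuterMeasure_blocks_bad_le hs A (svd R) hrank hε hε1 (hg R))
    intro j hj
    by_contra hcon
    exact (show _ < _ from hj).not_ge (hfin _ (not_lt.mp hcon))
  · rw [PMF.toOuterMeasure_pure_apply, if_neg]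
    · exact zero_le
    · -- Without columns the output is `0`, which is the projection of `A` onto the row space of `R`.
      have : IsEmpty (Fin R.rank) := by
        rw [Nat.eq_zero_of_not_pos hrank]
        infer_instance
      have hV : (svd R).V * (svd R).Vᵀ = 0 := by
        ext
        simp [Matrix.mul_apply]
      refine not_lt.mpr (hfin _ ?_)
      rw [Matrix.mul_assoc, hV, Factors.err]
      simp only [Matrix.mul_zero, Matrix.zero_mul, sub_zero]
      nlinarith [sq_nonneg ε, sq_nonneg (frobNorm A)]

theorem err_best_le {T : ℕ} (hT : 0 < T) (A : Matrix (Fin m) (Fin n) ℝ)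
    (X : Fin T → Factors m n s r) (t : Fin T) : (best hT A X).err A ≤ (X t).err A :=
  (Finset.exists_min_image Finset.univ (fun t => (X t).err A)
    ⟨⟨0, hT⟩, Finset.mem_univ _⟩).choose_spec.2 t (Finset.mem_univ t)

end Algorithm

/-! ### Boosting and the number of samples -/

section Boosting

variable {m n s k r : ℕ}

/-- The boosted algorithm fails only if all of its independent runs do. -/
theorem le_toOuterMeasure_boosted {T : ℕ} (hT : 0 < T) (hs : 0 < s) (hk : 0 < k)
    {A : Matrix (Fin m) (Fin n) ℝ} (D : CompactSVD A) (hkA : k ≤ A.rank)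
    (svd : (R : Matrix (Fin r) (Fin n) ℝ) → CompactSVD R)
    (g : Matrix (Fin r) (Fin n) ℝ → ℕ) {ε δ : ℝ} (hε : 0 < ε) (hε1 : ε < 1) (hδ : 0 < δ)
    (hr : 48 * ((k : ℝ) ^ 2 / ε ^ 2) ≤ r)
    (hg : ∀ R, 48 * ((r : ℝ) ^ 2 / (blockStableRank s (svd R).V * ε ^ 2)) ≤ g R)
    (hTδ : Real.log (1 / δ) ≤ T) :
    ENNReal.ofReal (1 - δ) ≤ (boosted T hT hs hk D hkA svd g).toOuterMeasure
      {X | X.err A ≤ (1 + ε) * frobNorm (A - D.trunc k hkA)} := by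
  refine toOuterMeasure_compl_le _ _ hδ.le ?_
  have hrun := toOuterMeasure_run_bad_le hs hk D hkA svd g hε hε1 hr hg
  set B : Set (Factors m n s r) :=
    {X | (1 + ε) * frobNorm (A - D.trunc k hkA) < X.err A} with hB
  -- All runs fail with probability at most `3⁻ᵀ ≤ e⁻ᵀ ≤ δ`.
  have hpow : ((1 : ℝ) / 3) ^ T ≤ δ := by
    have h3 : (1 : ℝ) / 3 ≤ Real.exp (-1) := by
      rw [Real.exp_neg, one_div]
      exact inv_anti₀ (Real.exp_pos 1) (Real.exp_one_lt_d9.le.trans (by norm_num))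
    calc ((1 : ℝ) / 3) ^ T ≤ Real.exp (-1) ^ T := by gcongr
      _ = Real.exp (-T) := by rw [← Real.exp_nat_mul]; ring_nf
      _ ≤ Real.exp (Real.log δ) := by
        rw [one_div, Real.log_inv] at hTδ
        exact Real.exp_le_exp.mpr (by linarith)
      _ = δ := Real.exp_log hδ
  rw [boosted, PMF.toOuterMeasure_map_apply]
  calc _ ≤ (iid (run hs hk D hkA svd g) T).toOuterMeasure {f | ∀ t, f t ∈ B} := by
        refine MeasureTheory.OuterMeasure.mono _ fun f hf t => ?_
        rw [Set.mem_preimage, Set.mem_compl_iff, Set.mem_ofPred_eq, not_le] at hf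
        exact lt_of_lt_of_le hf (err_best_le hT A f t)
    _ = (run hs hk D hkA svd g).toOuterMeasure B ^ T := toOuterMeasure_iid_forall _ _ _
    _ ≤ ENNReal.ofReal (1 / 3) ^ T := by gcongr
    _ = ENNReal.ofReal ((1 / 3) ^ T) := (ENNReal.ofReal_pow (by norm_num) T).symm
    _ ≤ ENNReal.ofReal δ := ENNReal.ofReal_le_ofReal hpow

/-- Rounding up at most doubles a number that is at least `1`. -/
theorem natCeil_le_two_mul {x : ℝ} (hx : 1 ≤ x) : (⌈x⌉₊ : ℝ) ≤ 2 * x := by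
  linarith [Nat.ceil_lt_add_one (zero_le_one.trans hx)]

/-- Rounding up the required number of blocks costs at most a factor `2`, because the block
stable rank of `R` is at most `rank R ≤ r`, so that the bound is at least `1` unless `R = 0`. -/
theorem natCeil_blocks_le (hs : 0 < s) (hr : 0 < r) {R : Matrix (Fin r) (Fin n) ℝ}
    (D : CompactSVD R) {ε : ℝ} (hε : 0 < ε) (hε1 : ε < 1) :
    (⌈48 * ((r : ℝ) ^ 2 / (blockStableRank s D.V * ε ^ 2))⌉₊ : ℝ) ≤
      96 * ((r : ℝ) ^ 2 / (blockStableRank s D.V * ε ^ 2)) := by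
  -- The block stable rank is `0` when `R = 0`; both sides then vanish, by division by zero.
  rcases (blockStableRank_nonneg D.V (s := s)).eq_or_lt with h0 | hα
  · simp [← h0]
  have hR : 0 < R.rank := by
    by_contra hR
    have : IsEmpty (Fin R.rank) := by
      rw [Nat.eq_zero_of_not_pos hR]
      infer_instance
    have : IsEmpty {i : Fin (n ⌈/⌉ s) // D.Vᵀ * blockSel n s i ≠ 0} :=
      ⟨fun i => i.2 (Subsingleton.elim _ _)⟩
    rw [blockStableRank, Real.iInf_of_isEmpty] at hα
    exact hα.false
  have h1 : blockStableRank s D.V ≤ r := (blockStableRank_le D.V hs hR D.orthoV).trans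
    (by simpa using (Nat.cast_le (α := ℝ)).mpr R.rank_le_card_height)
  have hr1 : (1 : ℝ) ≤ r := by exact_mod_cast hr
  have h2 : 1 ≤ (r : ℝ) ^ 2 / (blockStableRank s D.V * ε ^ 2) := by
    rw [one_le_div (by positivity)]
    have hε2 : ε ^ 2 ≤ 1 := by nlinarith
    nlinarith [mul_le_mul h1 hε2 (sq_nonneg ε) (by positivity)]
  linarith [natCeil_le_two_mul (x := 48 * ((r : ℝ) ^ 2 / (blockStableRank s D.V * ε ^ 2)))
    (by linarith)]

end Boosting

end BlockCUR

open BlockCUR in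
theorem corollary1 :
    ∃ c C : ℝ, 0 < c ∧ 0 < C ∧
      ∀ (m n s k : ℕ) (hs : 0 < s) (hk : 0 < k) (A : Matrix (Fin m) (Fin n) ℝ)
        (D : CompactSVD A) (hkA : k ≤ A.rank) (ε δ : ℝ),
        0 < ε → ε < 1 → 0 < δ → δ < 1 →
        (∀ (r T : ℕ) (hT : 0 < T) (svd : (R : Matrix (Fin r) (Fin n) ℝ) → CompactSVD R)
            (g : Matrix (Fin r) (Fin n) ℝ → ℕ),
            c * ((k : ℝ) ^ 2 / ε ^ 2) ≤ r →
            (∀ R, c * ((r : ℝ) ^ 2 / (blockStableRank s (svd R).V * ε ^ 2)) ≤ g R) →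
            Real.log (1 / δ) ≤ T →
            ENNReal.ofReal (1 - δ) ≤
              (boosted T hT hs hk D hkA svd g).toOuterMeasure
                {X | frobNorm (A - X.C * X.U * X.R) ≤ (1 + ε) * frobNorm (A - D.trunc k hkA)}) ∧
        (∃ r T : ℕ, 0 < T ∧
            c * ((k : ℝ) ^ 2 / ε ^ 2) ≤ r ∧
            Real.log (1 / δ) ≤ T ∧
            (T : ℝ) * r ≤ C * ((k : ℝ) ^ 2 / ε ^ 2) * ⌈Real.log (1 / δ)⌉₊ ∧
            ∀ svd : (R : Matrix (Fin r) (Fin n) ℝ) → CompactSVD R,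
              ∃ g : Matrix (Fin r) (Fin n) ℝ → ℕ, ∀ R,
                c * ((r : ℝ) ^ 2 / (blockStableRank s (svd R).V * ε ^ 2)) ≤ g R ∧
                (T : ℝ) * g R ≤ C * ((r : ℝ) ^ 2 / (blockStableRank s (svd R).V * ε ^ 2)) *
                  ⌈Real.log (1 / δ)⌉₊) := by
  refine ⟨48, 96, by norm_num, by norm_num, ?_⟩
  intro m n s k hs hk A D hkA ε δ hε hε1 hδ hδ1
  refine ⟨fun r T hT svd g hr hg hTδ =>
    le_toOuterMeasure_boosted hT hs hk D hkA svd g hε hε1 hδ hr hg hTδ, ?_⟩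
  have hlog : 0 < Real.log (1 / δ) := Real.log_pos (by rwa [lt_div_iff₀ hδ, one_mul])
  have hk1 : 1 ≤ (k : ℝ) ^ 2 / ε ^ 2 := by
    rw [one_le_div (by positivity)]
    have : (1 : ℝ) ≤ k := by exact_mod_cast hk
    exact pow_le_pow_left₀ hε.le (hε1.le.trans this) 2
  have hr := natCeil_le_two_mul (x := 48 * ((k : ℝ) ^ 2 / ε ^ 2)) (by linarith)
  refine ⟨⌈48 * ((k : ℝ) ^ 2 / ε ^ 2)⌉₊, ⌈Real.log (1 / δ)⌉₊, Nat.ceil_pos.mpr hlog,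
    Nat.le_ceil _, Nat.le_ceil _, ?_, fun svd => ⟨fun R => ⌈_⌉₊, fun R =>
      ⟨Nat.le_ceil _, ?_⟩⟩⟩
  · rw [mul_comm]
    gcongr
    linarith
  · rw [mul_comm]
    gcongr
    exact natCeil_blocks_le hs (Nat.ceil_pos.mpr (by linarith)) (svd R) hε hε1
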